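/- Let $k$ be a field, let $n\ge 2$ and $d\ge 1$ be integers, let $R=k[X_1,\dots,X_n]$ with its standard grading, and put $\mathfrak m=(X_1,\dots,X_n)$. For forms $\mathbf f=(f_0,\dots,f_n)$ of degree $d$ in $R$, let $H_1=H_1(\mathbf f;R)$ be the first homology module of the Koszul complex of $\mathbf f$, graded so that the term of degree one of the complex is $R(-d)^{n+1}$, and let $H^0_{\mathfrak m}(H_1)$ be the submodule of the elements of $H_1$ annihilated by some power of $\mathfrak m$. For a graded module $M$ put $\operatorname{indeg}(M)=\inf\{\nu : M_\nu\neq 0\}$, with $\operatorname{indeg}(0)=+\infty$. The threshold degree of $I=(f_0,\dots,f_n)$ is $$\mu_0(I)=(n-1)(d-1)-\min\{\operatorname{indeg}(H_1),\ \operatorname{indeg}(H^0_{\mathfrak m}(H_1))-d\}.$$ (1) If $f_0,\dots,f_n$ are $k$-linearly independent and $I$ is $\mathfrak m$-primary, then $\mu_0(I)$ is a (finite) integer and $$\left\lfloor\frac{(n-1)(d-1)}{2}\right\rfloor\le\mu_0(I)\le (n-1)(d-1).$$ (2) If $k$ has characteristic $0$, then equality holds on the left for sufficiently general forms: there is a nonempty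 Zariski open subset $U$ of the affine space (over $k$) of the coefficients of $(n+1)$-tuples of forms of degree $d$ such that, for every $(f_0,\dots,f_n)\in U$, the ideal $I=(f_0,\dots,f_n)$ is $\mathfrak m$-primary, $\mu_0(I)=\left\lfloor\frac{(n-1)(d-1)}{2}\right\rfloor$ (with $\mu_0(I)$ defined by the formula above for these forms), and, if $d\ge 2$, the forms $f_0,\dots,f_n$ are $k$-linearly independent. -/

import Mathlib

open MvPolynomial

noncomputable section

namespace ThresholdDegree

/-- The zeroth local cohomology `H⁰_𝔞(M)`: the submodule of all elements of `M` that are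
annihilated by some power of the ideal `𝔞`. -/
def localCohomologyZero {R : Type*} [CommRing R] (𝔞 : Ideal R)
    (M : Type*) [AddCommGroup M] [Module R M] : Submodule R M where
  carrier := {x | ∃ N : ℕ, ∀ a ∈ 𝔞 ^ N, a • x = 0}
  zero_mem' := ⟨0, fun a _ => smul_zero a⟩
  add_mem' := by
    rintro x y ⟨N, hN⟩ ⟨N', hN'⟩
    refine ⟨N + N', fun a ha => ?_⟩
    rw [smul_add, hN a (Ideal.pow_le_pow_right (Nat.le_add_right N N') ha),
      hN' a (Ideal.pow_le_pow_right (Nat.le_add_left N' N) ha), add_zero]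
  smul_mem' := by
    rintro r x ⟨N, hN⟩
    exact ⟨N, fun a ha => by rw [smul_comm, hN a ha, smul_zero]⟩

/-- The initial degree `inf {ν | M_ν ≠ 0}` of a graded vector space with graded pieces
`M_ν`, with the convention that it is `+∞` if all the pieces vanish. -/
def indeg {k M : Type*} [Field k] [AddCommGroup M] [Module k M]
    (piece : ℕ → Submodule k M) : EReal :=
  sInf {e : EReal | ∃ ν : ℕ, piece ν ≠ ⊥ ∧ e = (ν : EReal)}

section Koszul

variable {R : Type*} [CommRing R] {n : ℕ} (f : Fin (n + 1) → R)

/-- The differential `K₁ = R^{n+1} → K₀ = R`, `e_i ↦ f_i`, of the Koszul complex of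
`f_0, …, f_n`. -/
def koszulD1 : (Fin (n + 1) → R) →ₗ[R] R :=
  Fintype.linearCombination R f

/-- The differential `K₂ → K₁` of the Koszul complex of `f_0, …, f_n`; here `K₂ = ⋀² K₁` is
the free module on the elements `e_i ∧ e_j` with `i < j`, and
`e_i ∧ e_j ↦ f_i e_j - f_j e_i`. -/
def koszulD2 :
    ({p : Fin (n + 1) × Fin (n + 1) // p.1 < p.2} → R) →ₗ[R] (Fin (n + 1) → R) :=
  Fintype.linearCombination R fun p =>
    f p.1.1 • Pi.single p.1.2 (1 : R) - f p.1.2 • Pi.single p.1.1 (1 : R)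

theorem koszulD1_comp_koszulD2 : koszulD1 f ∘ₗ koszulD2 f = 0 := by
  refine LinearMap.pi_ext' fun p => LinearMap.ext_ring ?_
  simp [koszulD1, koszulD2, Fintype.linearCombination_apply_single, mul_comm]

/-- The module `Z₁` of first Koszul cycles (the syzygies of `f_0, …, f_n`). -/
abbrev koszulZ1 : Submodule R (Fin (n + 1) → R) := LinearMap.ker (koszulD1 f)

/-- The module `B₁` of first Koszul boundaries. -/
abbrev koszulB1 : Submodule R (Fin (n + 1) → R) := LinearMap.range (koszulD2 f)

/-- The first Koszul homology module `H₁ = Z₁ / B₁`. -/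
abbrev koszulH1 : Type _ := ↥(koszulZ1 f) ⧸ (koszulB1 f).submoduleOf (koszulZ1 f)

end Koszul

section Polynomial

variable {k : Type*} [Field k] {n : ℕ}

/-- The graded piece of degree `ν` of `K₁ = R(-d)^{n+1}`, where `R = k[X_1, …, X_n]`: the
tuples of forms of degree `ν - d` (only the zero tuple if `ν < d`). -/
def K1Piece (k : Type*) [Field k] (n d ν : ℕ) :
    Submodule k (Fin (n + 1) → MvPolynomial (Fin n) k) :=
  Submodule.pi Set.univ fun _ => if d ≤ ν then homogeneousSubmodule (Fin n) k (ν - d) else ⊥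

/-- The graded piece of degree `ν` of the Koszul homology module `H₁` of forms `f_0, …, f_n`
of degree `d`: the classes of the cycles that are homogeneous of degree `ν` in `K₁`. -/
def H1Piece (d : ℕ) (f : Fin (n + 1) → MvPolynomial (Fin n) k) (ν : ℕ) :
    Submodule k (koszulH1 f) :=
  ((K1Piece k n d ν).comap ((koszulZ1 f).subtype.restrictScalars k)).map
    (((koszulB1 f).submoduleOf (koszulZ1 f)).mkQ.restrictScalars k)

/-- The graded piece of degree `ν` of `H⁰_𝔪(H₁)`, where `𝔪 = (X_1, …, X_n)`. -/
def H0mH1Piece (d : ℕ) (f : Fin (n + 1) → MvPolynomial (Fin n) k) (ν : ℕ) :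
    Submodule k (koszulH1 f) :=
  H1Piece d f ν ⊓
    (localCohomologyZero (idealOfVars (Fin n) k) (koszulH1 f)).restrictScalars k

/-- The threshold degree
`μ₀ = (n-1)(d-1) - min {indeg H₁, indeg H⁰_𝔪(H₁) - d}` of the ideal generated by the forms
`f_0, …, f_n` of degree `d`. -/
def thresholdDegree (d : ℕ) (f : Fin (n + 1) → MvPolynomial (Fin n) k) : EReal :=
  ((((n : ℝ) - 1) * ((d : ℝ) - 1) : ℝ) : EReal)
    - min (indeg (H1Piece d f)) (indeg (H0mH1Piece d f) - (d : EReal))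

/-- The ideal `I` is `𝔪`-primary, where `𝔪 = (X_1, …, X_n)`. -/
def IsMPrimary (I : Ideal (MvPolynomial (Fin n) k)) : Prop :=
  I.IsPrimary ∧ I.radical = idealOfVars (Fin n) k

/-- The affine space of all `(n+1)`-tuples of forms of degree `d` in `k[X_1, …, X_n]`. -/
abbrev FormTuple (k : Type*) [Field k] (n d : ℕ) : Type _ :=
  Fin (n + 1) → homogeneousSubmodule (Fin n) k d

/-- The underlying tuple of polynomials. -/
def FormTuple.poly {d : ℕ} (f : FormTuple k n d) : Fin (n + 1) → MvPolynomial (Fin n) k :=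
  fun i => (f i : MvPolynomial (Fin n) k)

/-- The coordinates of a tuple of forms: all the coefficients, at the monomials of degree
`d`. -/
def FormTuple.coords {d : ℕ} (f : FormTuple k n d) :
    Fin (n + 1) × {α : Fin n →₀ ℕ // α.degree = d} → k :=
  fun p => coeff p.2.1 (f.poly p.1)

/-- Zariski open subsets of the affine space of tuples of forms: the complements of the
common zero loci of sets of polynomials in the coefficients. -/
def IsZariskiOpen {d : ℕ} (U : Set (FormTuple k n d)) : Prop :=
  ∃ S : Set (MvPolynomial (Fin (n + 1) × {α : Fin n →₀ ℕ // α.degree = d}) k),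
    U = {f | ∃ P ∈ S, eval f.coords P ≠ 0}

end Polynomial

end ThresholdDegree

end

/-! Everything reduces to the least degree `e'` of the entries of a non-Koszul syzygy of the forms.
The ideal `I` kills `H₁`, so if `I` is `𝔪`-primary then `H⁰_𝔪(H₁) = H₁`. As `K₁ = R(-d)^{n+1}`, the
initial degree of `H₁` is `e' + d`, and the minimum in the formula is `e'` (`thresholdDegree_eq`).
The upper bound is then `e' ≥ 0`. The lower bound says `e' ≤ e := ⌈(n-1)(d-1)/2⌉`; equality for
general forms says that there is no non-Koszul syzygy below degree `e`.

Both use semicontinuity. By rank-nullity, `ExactInDegree` says that the ranks of the ideal piece and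
of the Koszul piece attain their maximal possible sum. Each rank is lower semicontinuous in the
coefficients, so exactness is an open condition, and the Hilbert function of the ideal is constant
near an exact tuple (`exists_forall_exactInDegree`).

Lower bound (`not_exactInDegree`): if `f` were exact in degree `e`, so would be the generic member,
over `k(t)`, of the pencil joining `f` to `(0, X_1^d, …, X_n^d)`. The quotient `A` by its last `n`
forms has the Hilbert function of the monomial complete intersection in degrees `e` and `e + d`, and
exactness makes multiplication by the zeroth form injective from `A_e` to `A_{e+d}`. Symmetry and
strict unimodality of that Hilbert function give `dim A_{e+d} < dim A_e`, a contradiction.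

Generic equality (`exists_isZariskiOpen`): by openness one example suffices, namely `ℓ^d, X_1^d, …,
X_n^d` with `ℓ = X_1 + ⋯ + X_n`. Its exactness below degree `e` is the injectivity of multiplication
by `ℓ^d`, an instance of the strong Lefschetz property in characteristic zero, proved with an `sl₂`
lowering operator (`mem_of_sum_X_pow_mul_mem`). -/

noncomputable section

namespace ThresholdDegree

/-! ### Lower semicontinuity of rank under specialization -/

section Semicontinuity

/-- Linearly independent functions have a nonvanishing minor. -/
theorem exists_det_ne_zero {L ι X : Type*} [Field L] [Fintype ι] [DecidableEq ι]
    {v : ι → X → L} (hv : LinearIndependent L v) :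
    ∃ x : ι → X, (Matrix.of fun j i => v i (x j)).det ≠ 0 := by
  set w : X → ι → L := fun x i => v i x with hw
  -- A functional vanishing on every evaluation vector `w x` is a linear relation among the `v i`.
  have hspan : Submodule.span L (Set.range w) = ⊤ := by
    by_contra h
    obtain ⟨g, hg, hker⟩ := Submodule.exists_le_ker_of_lt_top _ (lt_top_iff_ne_top.2 h)
    apply hg
    have hz : ∑ i, g (Pi.single i 1) • v i = 0 := by
      ext x
      have hx : w x ∈ LinearMap.ker g := hker (Submodule.subset_span ⟨x, rfl⟩)
      rw [LinearMap.mem_ker, LinearMap.pi_apply_eq_sum_univ] at hx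
      have h1 : ∀ i : ι, (fun j => if i = j then (1 : L) else 0) = Pi.single i 1 := fun i => by
        ext j
        simp [Pi.single_apply, eq_comm]
      simpa [hw, mul_comm, h1] using hx
    have hi := Fintype.linearIndependent_iff.1 hv _ hz
    refine LinearMap.pi_ext' fun i => LinearMap.ext_ring ?_
    simpa using hi i
  obtain ⟨κ, a, -, ha, hli⟩ := exists_linearIndependent' L w
  let b : Module.Basis κ L (ι → L) := Module.Basis.mk hli (by rw [ha, hspan])
  let e : κ ≃ ι := b.indexEquiv (Pi.basisFun L ι)
  refine ⟨a ∘ e.symm, ?_⟩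
  have h2 : LinearIndependent L ((w ∘ a) ∘ e.symm) := hli.comp _ e.symm.injective
  have h3 := (Matrix.linearIndependent_rows_iff_isUnit
    (A := Matrix.of fun j i => v i ((a ∘ e.symm) j))).1 h2
  exact ((Matrix.isUnit_iff_isUnit_det _).1 h3).ne_zero

universe w

/-- Lower semicontinuity of the rank of a finite family of vectors. -/
theorem exists_forall_finrank_span_le {D L κ X : Type*} [CommRing D] [Field L] [Finite κ]
    (v : κ → X → D) (φ : D →+* L) :
    ∃ P : D, φ P ≠ 0 ∧ ∀ (K : Type w) [Field K] (ψ : D →+* K), ψ P ≠ 0 →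
      Module.finrank L (Submodule.span L (Set.range fun c x => φ (v c x))) ≤
        Module.finrank K (Submodule.span K (Set.range fun c x => ψ (v c x))) := by
  classical
  obtain ⟨ι, a, ha, hspan, hli⟩ := exists_linearIndependent' L (fun c x => φ (v c x))
  have : Finite ι := Finite.of_injective a ha
  have := Fintype.ofFinite ι
  obtain ⟨x, hx⟩ := exists_det_ne_zero hli
  have hmap : ∀ {K : Type _} [Field K] (ψ : D →+* K),
      ψ (Matrix.of fun j i => v (a i) (x j)).det =
        (Matrix.of fun j i => ψ (v (a i) (x j))).det := by
    intro K _ ψ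
    rw [RingHom.map_det]
    rfl
  have hmap' : ∀ {K : Type w} [Field K] (ψ : D →+* K),
      ψ (Matrix.of fun j i => v (a i) (x j)).det =
        (Matrix.of fun j i => ψ (v (a i) (x j))).det := by
    intro K _ ψ
    rw [RingHom.map_det]
    rfl
  refine ⟨(Matrix.of fun j i => v (a i) (x j)).det, by rw [hmap]; exact hx,
    fun K _ ψ hψ => ?_⟩
  rw [hmap'] at hψ
  have hli' : LinearIndependent K (fun i x => ψ (v (a i) x)) := by
    have h1 : LinearIndependent K (fun i j => ψ (v (a i) (x j))) := by
      rw [← Matrix.det_transpose] at hψ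
      exact Matrix.linearIndependent_rows_iff_isUnit.2
        ((Matrix.isUnit_iff_isUnit_det _).2 (isUnit_iff_ne_zero.2 hψ))
    exact LinearIndependent.of_comp (LinearMap.funLeft K K x) h1
  rw [← hspan, finrank_span_eq_card hli, ← finrank_span_eq_card hli']
  have : Module.Finite K (Submodule.span K (Set.range fun c x => ψ (v c x))) :=
    Module.Finite.span_of_finite K (Set.finite_range _)
  refine Submodule.finrank_mono (Submodule.span_mono ?_)
  rintro _ ⟨i, rfl⟩
  exact ⟨a i, rfl⟩

/-- The coefficients of a tuple of polynomials. -/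
def coeffTuple (K σ ι : Type*) [CommSemiring K] :
    (ι → MvPolynomial σ K) →ₗ[K] (ι × (σ →₀ ℕ) → K) :=
  LinearMap.pi fun p => lcoeff K p.2 ∘ₗ LinearMap.proj p.1

theorem coeffTuple_injective (K σ ι : Type*) [CommSemiring K] :
    Function.Injective (coeffTuple K σ ι) := by
  intro a b h
  funext i
  ext α
  exact congrFun h (i, α)

theorem finrank_span_comp_of_injective {K M N κ : Type*} [Field K] [AddCommGroup M] [Module K M]
    [AddCommGroup N] [Module K N] (g : M →ₗ[K] N) (hg : Function.Injective g) (v : κ → M) :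
    Module.finrank K (Submodule.span K (Set.range (g ∘ v))) =
      Module.finrank K (Submodule.span K (Set.range v)) := by
  rw [Set.range_comp, ← Submodule.map_span]
  exact (LinearEquiv.finrank_eq (Submodule.equivMapOfInjective g hg _)).symm

theorem exists_forall_finrank_span_tuple_le {D L κ σ ι : Type*} [CommRing D] [Field L] [Finite κ]
    (v : κ → ι → MvPolynomial σ D) (φ : D →+* L) :
    ∃ P : D, φ P ≠ 0 ∧ ∀ (K : Type w) [Field K] (ψ : D →+* K), ψ P ≠ 0 →
      Module.finrank L (Submodule.span L (Set.range fun c i => map φ (v c i))) ≤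
        Module.finrank K (Submodule.span K (Set.range fun c i => map ψ (v c i))) := by
  obtain ⟨P, hP, h⟩ := exists_forall_finrank_span_le
    (fun c (p : ι × (σ →₀ ℕ)) => coeff p.2 (v c p.1)) φ
  refine ⟨P, hP, fun K _ ψ hψ => ?_⟩
  have := h K ψ hψ
  rw [← finrank_span_comp_of_injective _ (coeffTuple_injective L σ ι),
    ← finrank_span_comp_of_injective _ (coeffTuple_injective K σ ι)]
  simpa only [coeffTuple, Function.comp_def, coeff_map, LinearMap.pi_apply, LinearMap.comp_apply,
    LinearMap.proj_apply, lcoeff_apply] using! this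

theorem exists_forall_finrank_span_poly_le {D L κ σ : Type*} [CommRing D] [Field L] [Finite κ]
    (v : κ → MvPolynomial σ D) (φ : D →+* L) :
    ∃ P : D, φ P ≠ 0 ∧ ∀ (K : Type w) [Field K] (ψ : D →+* K), ψ P ≠ 0 →
      Module.finrank L (Submodule.span L (Set.range fun c => map φ (v c))) ≤
        Module.finrank K (Submodule.span K (Set.range fun c => map ψ (v c))) := by
  obtain ⟨P, hP, h⟩ := exists_forall_finrank_span_tuple_le (fun c (_ : Unit) => v c) φ
  refine ⟨P, hP, fun K _ ψ hψ => ?_⟩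
  have := h K ψ hψ
  rwa [← finrank_span_comp_of_injective
      (LinearMap.pi fun _ : Unit => (LinearMap.id : MvPolynomial σ L →ₗ[L] _))
      (fun a b h => congrFun h ()),
    ← finrank_span_comp_of_injective
      (LinearMap.pi fun _ : Unit => (LinearMap.id : MvPolynomial σ K →ₗ[K] _))
      (fun a b h => congrFun h ())]

end Semicontinuity

/-! ### Graded pieces of the ideal and of the Koszul syzygies; exactness as a rank condition -/

section GradedPieces

/-- The exponents `β` of monomials with `|β| + d = j`. -/
abbrev Exponent (σ : Type*) (d j : ℕ) : Type _ := {β : σ →₀ ℕ // β.degree + d = j}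

instance {σ : Type*} [Finite σ] (d j : ℕ) : Finite (Exponent σ d j) :=
  ((Finsupp.finite_of_degree_le j).subset fun β (hβ : β.degree + d = j) => by
    simp only [Set.mem_ofPred_eq]; omega : {β : σ →₀ ℕ | β.degree + d = j}.Finite).to_subtype

theorem homogeneousComponent_mul_of_isHomogeneous {σ K : Type*} [CommSemiring K]
    {g : MvPolynomial σ K} {d : ℕ} (hg : g.IsHomogeneous d) (j : ℕ) (r : MvPolynomial σ K) :
    homogeneousComponent j (r * g) =
      (if d ≤ j then homogeneousComponent (j - d) r else 0) * g := by
  have key : ∀ i, homogeneousComponent j (homogeneousComponent i r * g) =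
      (if d ≤ j then homogeneousComponent (j - d) (homogeneousComponent i r) else 0) * g := by
    intro i
    have hi := homogeneousComponent_isHomogeneous i r
    rw [homogeneousComponent_of_mem (hi.mul hg)]
    by_cases hdj : d ≤ j
    · rw [if_pos hdj, homogeneousComponent_of_mem hi]
      by_cases hij : j = i + d
      · rw [if_pos hij, if_pos (by omega)]
      · rw [if_neg hij, if_neg (by omega), zero_mul]
    · rw [if_neg hdj, if_neg (by omega), zero_mul]
  conv_lhs => rw [← sum_homogeneousComponent r, Finset.sum_mul, map_sum,
    Finset.sum_congr rfl fun i _ => key i, ← Finset.sum_mul]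
  congr 1
  split_ifs
  · rw [← map_sum, sum_homogeneousComponent]
  · simp

/-- A homogeneous element of a submodule generated by homogeneous elements `g c` of degree `d` is
a linear combination of monomial multiples of the `g c` of the right degree. -/
theorem mem_span_monomial_smul {K σ N κ : Type*} [Field K] [AddCommGroup N]
    [Module (MvPolynomial σ K) N] [Module K N] [IsScalarTower K (MvPolynomial σ K) N] [Finite κ]
    (g : κ → N) (d j : ℕ) (π : N →ₗ[K] N)
    (hπ : ∀ (r : MvPolynomial σ K) c, π (r • g c) = (if d ≤ j then homogeneousComponent (j - d) r else 0) • g c)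
    {a : N} (ha : a ∈ Submodule.span (MvPolynomial σ K) (Set.range g)) (hπa : π a = a) :
    a ∈ Submodule.span K
      (Set.range fun p : κ × Exponent σ d j => monomial (p.2 : σ →₀ ℕ) (1 : K) • g p.1) := by
  have := Fintype.ofFinite κ
  obtain ⟨r, rfl⟩ := (Submodule.mem_span_range_iff_exists_fun _).1 ha
  rw [← hπa, map_sum]
  refine Submodule.sum_mem _ fun c _ => ?_
  rw [hπ]
  split_ifs with hdj
  · rw [as_sum (homogeneousComponent (j - d) (r c)), Finset.sum_smul]
    refine Submodule.sum_mem _ fun β hβ => ?_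
    have hdeg : β.degree + d = j := by
      by_contra h
      refine (mem_support_iff.1 hβ) ?_
      rw [coeff_homogeneousComponent, if_neg (by omega)]
    have : (monomial β (coeff β (homogeneousComponent (j - d) (r c))) : MvPolynomial σ K) • g c =
        (coeff β (homogeneousComponent (j - d) (r c))) • (monomial β (1 : K) • g c) := by
      rw [← smul_assoc, smul_monomial, smul_eq_mul, mul_one]
    rw [this]
    exact Submodule.smul_mem _ _ (Submodule.subset_span ⟨(c, ⟨β, hdeg⟩), rfl⟩)
  · rw [zero_smul]
    exact Submodule.zero_mem _

variable {σ K ι : Type*}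

/-- The degree `j` part of the ideal generated by forms `f i` of degree `d`. -/
def idealPiece [CommRing K] (f : ι → MvPolynomial σ K) (d j : ℕ) :
    Submodule K (MvPolynomial σ K) :=
  Submodule.span K (Set.range fun p : ι × Exponent σ d j =>
    monomial (p.2 : σ →₀ ℕ) (1 : K) * f p.1)

theorem mem_ideal_of_mem_idealPiece [CommRing K] {f : ι → MvPolynomial σ K} {d j : ℕ}
    {p : MvPolynomial σ K} (hp : p ∈ idealPiece f d j) : p ∈ Ideal.span (Set.range f) := by
  have : idealPiece f d j ≤ (Ideal.span (Set.range f)).restrictScalars K := by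
    refine Submodule.span_le.2 ?_
    rintro _ ⟨q, rfl⟩
    exact Ideal.mul_mem_left _ _ (Ideal.subset_span ⟨q.1, rfl⟩)
  exact this hp

theorem idealPiece_le_homogeneousSubmodule [CommRing K] {f : ι → MvPolynomial σ K} {d : ℕ}
    (hf : ∀ i, (f i).IsHomogeneous d) (j : ℕ) :
    idealPiece f d j ≤ homogeneousSubmodule σ K j := by
  refine Submodule.span_le.2 ?_
  rintro _ ⟨q, rfl⟩
  have := (isHomogeneous_monomial (1 : K) (rfl : (q.2 : σ →₀ ℕ).degree = _)).mul (hf q.1)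
  rwa [q.2.2] at this

theorem mem_idealPiece [Field K] [Finite ι] {f : ι → MvPolynomial σ K} {d j : ℕ}
    (hf : ∀ i, (f i).IsHomogeneous d) {p : MvPolynomial σ K} (hp : p.IsHomogeneous j)
    (hmem : p ∈ Ideal.span (Set.range f)) : p ∈ idealPiece f d j :=
  mem_span_monomial_smul f d j (homogeneousComponent j)
    (fun r c => homogeneousComponent_mul_of_isHomogeneous (hf c) j r) hmem
    (homogeneousComponent_eq_self hp)

/-- The Koszul syzygy `f i e_j - f j e_i`. -/
def koszulSyzygy {R : Type*} [CommRing R] [DecidableEq ι] (f : ι → R) (p : ι × ι) : ι → R :=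
  f p.1 • Pi.single p.2 (1 : R) - f p.2 • Pi.single p.1 (1 : R)

/-- Every syzygy of the `f i` by forms of degree `e` is a combination of Koszul syzygies. -/
def ExactInDegree [CommRing K] [Fintype ι] [DecidableEq ι] (f : ι → MvPolynomial σ K) (e : ℕ) :
    Prop :=
  ∀ a : ι → MvPolynomial σ K, (∀ i, (a i).IsHomogeneous e) → ∑ i, a i * f i = 0 →
    a ∈ Submodule.span (MvPolynomial σ K) (Set.range (koszulSyzygy f))

theorem koszulSyzygy_apply_isHomogeneous [CommRing K] [DecidableEq ι] {f : ι → MvPolynomial σ K}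
    {d : ℕ} (hf : ∀ i, (f i).IsHomogeneous d) (p : ι × ι) (i : ι) :
    (koszulSyzygy f p i).IsHomogeneous d := by
  have : ∀ a b : ι, (f a • (Pi.single b (1 : MvPolynomial σ K) : ι → MvPolynomial σ K)) i ∈
      homogeneousSubmodule σ K d := by
    intro a b
    by_cases h : i = b
    · subst h
      simpa using hf a
    · simp [h]
  exact Submodule.sub_mem _ (this _ _) (this _ _)

theorem sum_koszulSyzygy_mul {R : Type*} [CommRing R] [Fintype ι] [DecidableEq ι] (f : ι → R)
    (p : ι × ι) : ∑ i, koszulSyzygy f p i * f i = 0 := by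
  simp [koszulSyzygy, sub_mul, Pi.single_apply, Finset.sum_sub_distrib, mul_comm (f p.1)]

/-- The degree `e` part of the module of Koszul syzygies of forms of degree `d`. -/
def koszulPiece [CommRing K] [DecidableEq ι] (f : ι → MvPolynomial σ K) (d e : ℕ) :
    Submodule K (ι → MvPolynomial σ K) :=
  Submodule.span K (Set.range fun p : (ι × ι) × Exponent σ d e =>
    monomial (p.2 : σ →₀ ℕ) (1 : K) • koszulSyzygy f p.1)

theorem mem_span_of_mem_koszulPiece [CommRing K] [DecidableEq ι] {f : ι → MvPolynomial σ K}
    {d e : ℕ} {a : ι → MvPolynomial σ K} (ha : a ∈ koszulPiece f d e) :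
    a ∈ Submodule.span (MvPolynomial σ K) (Set.range (koszulSyzygy f)) := by
  have : koszulPiece f d e ≤
      (Submodule.span (MvPolynomial σ K) (Set.range (koszulSyzygy f))).restrictScalars K := by
    refine Submodule.span_le.2 ?_
    rintro _ ⟨q, rfl⟩
    exact Submodule.smul_mem _ _ (Submodule.subset_span (Set.mem_range_self q.1))
  exact this ha

theorem mem_koszulPiece [Field K] [Finite ι] [DecidableEq ι] {f : ι → MvPolynomial σ K} {d e : ℕ}
    (hf : ∀ i, (f i).IsHomogeneous d) {a : ι → MvPolynomial σ K} (ha : ∀ i, (a i).IsHomogeneous e)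
    (hmem : a ∈ Submodule.span (MvPolynomial σ K) (Set.range (koszulSyzygy f))) :
    a ∈ koszulPiece f d e := by
  refine mem_span_monomial_smul (koszulSyzygy f) d e
    (LinearMap.pi fun i => homogeneousComponent e ∘ₗ LinearMap.proj i) (fun r c => ?_) hmem ?_
  · funext i
    exact homogeneousComponent_mul_of_isHomogeneous (koszulSyzygy_apply_isHomogeneous hf c i) e r
  · funext i
    exact homogeneousComponent_eq_self (ha i)

/-- The tuples `x^β e_i` with `|β| + d = j`. -/
def monomialTuple (K : Type*) [CommRing K] [DecidableEq ι] (d j : ℕ) (p : ι × Exponent σ d j) :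
    ι → MvPolynomial σ K :=
  Pi.single p.1 (monomial (p.2 : σ →₀ ℕ) 1)

theorem linearIndependent_monomialTuple [Field K] [Finite ι] [DecidableEq ι] (d j : ℕ) :
    LinearIndependent K (monomialTuple (σ := σ) (ι := ι) K d j) := by
  have := Fintype.ofFinite ι
  have h := (Pi.basis fun _ : ι => basisMonomials σ K).linearIndependent.comp
    (fun p : ι × Exponent σ d j => ⟨p.1, (p.2 : σ →₀ ℕ)⟩) (by
      rintro ⟨i, β⟩ ⟨i', β'⟩ h
      simp only [Sigma.mk.injEq, heq_eq_eq] at h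
      exact Prod.ext h.1 (Subtype.ext h.2))
  have h2 : (Pi.basis fun _ : ι => basisMonomials σ K) ∘
      (fun p : ι × Exponent σ d j => ⟨p.1, (p.2 : σ →₀ ℕ)⟩) = monomialTuple K d j := by
    funext p
    simp [monomialTuple, Pi.basis_apply]
  rwa [h2] at h

theorem mem_span_monomialTuple [Field K] [Finite ι] [DecidableEq ι] {d e : ℕ}
    {a : ι → MvPolynomial σ K} :
    a ∈ Submodule.span K (Set.range (monomialTuple (σ := σ) (ι := ι) K d (e + d))) ↔
      ∀ i, (a i).IsHomogeneous e := by
  have := Fintype.ofFinite ι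
  constructor
  · intro ha i
    have : Submodule.span K (Set.range (monomialTuple (σ := σ) (ι := ι) K d (e + d))) ≤
        (homogeneousSubmodule σ K e).comap (LinearMap.proj i) := by
      refine Submodule.span_le.2 ?_
      rintro _ ⟨⟨i', β, hβ⟩, rfl⟩
      simp only [SetLike.mem_coe, Submodule.mem_comap, LinearMap.proj_apply, monomialTuple]
      by_cases h : i = i'
      · subst h
        rw [Pi.single_eq_same]
        exact isHomogeneous_monomial _ (by omega)
      · rw [Pi.single_eq_of_ne h]
        exact Submodule.zero_mem _
    exact this ha
  · intro ha
    rw [← Finset.univ_sum_single a]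
    refine Submodule.sum_mem _ fun i _ => ?_
    rw [as_sum (a i)]
    have : (Pi.single i (∑ β ∈ (a i).support, monomial β (coeff β (a i))) :
        ι → MvPolynomial σ K) =
        ∑ β ∈ (a i).support, coeff β (a i) • Pi.single i (monomial β (1 : K)) := by
      rw [← LinearMap.single_apply (R := K) (φ := fun _ : ι => MvPolynomial σ K), map_sum]
      refine Finset.sum_congr rfl fun β _ => ?_
      rw [LinearMap.single_apply, ← Pi.single_smul', smul_monomial, smul_eq_mul, mul_one]
    rw [this]
    refine Submodule.sum_mem _ fun β hβ => Submodule.smul_mem _ _ (Submodule.subset_span ?_)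
    refine ⟨(i, ⟨β, ?_⟩), rfl⟩
    by_contra h
    exact (mem_support_iff.1 hβ) ((ha i).coeff_eq_zero (by omega))

/-- The rank-nullity formula for the map `a ↦ ∑ a i * f i` on tuples of forms of degree `e`. -/
theorem finrank_idealPiece_add_finrank_ker [Field K] [Finite σ] [Fintype ι] [DecidableEq ι]
    (f : ι → MvPolynomial σ K) (d e : ℕ) :
    Module.finrank K (idealPiece f d (e + d)) +
      Module.finrank K
        (LinearMap.ker ((Fintype.linearCombination (MvPolynomial σ K) f).restrictScalars K) ⊓
          Submodule.span K (Set.range (monomialTuple (σ := σ) (ι := ι) K d (e + d))) :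
          Submodule K (ι → MvPolynomial σ K)) = Nat.card (ι × Exponent σ d (e + d)) := by
  set T := (Fintype.linearCombination (MvPolynomial σ K) f).restrictScalars K
  set W := Submodule.span K (Set.range (monomialTuple (σ := σ) (ι := ι) K d (e + d)))
  have : Module.Finite K W := Module.Finite.span_of_finite K (Set.finite_range _)
  have h1 := LinearMap.finrank_range_add_finrank_ker (T.domRestrict W)
  have h2 : LinearMap.range (T.domRestrict W) = idealPiece f d (e + d) := by
    rw [LinearMap.range_domRestrict, Submodule.map_span, ← Set.range_comp]
    congr 2
    funext p
    simp [T, monomialTuple, Fintype.linearCombination_apply_single]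
  have h3 : Module.finrank K (LinearMap.ker (T.domRestrict W)) =
      Module.finrank K (LinearMap.ker T ⊓ W : Submodule K (ι → MvPolynomial σ K)) := by
    rw [← Submodule.finrank_map_subtype_eq W (LinearMap.ker (T.domRestrict W))]
    refine congrArg (fun S : Submodule K (ι → MvPolynomial σ K) => Module.finrank K S) ?_
    rw [LinearMap.ker_domRestrict, inf_comm]
    exact Submodule.map_comap_subtype W (LinearMap.ker T)
  have := Fintype.ofFinite (Exponent σ d (e + d))
  rw [← h2, ← h3, h1, Nat.card_eq_fintype_card]
  exact finrank_span_eq_card (linearIndependent_monomialTuple d (e + d))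

/-- The Koszul piece lies in the kernel of `a ↦ ∑ a i * f i`, whose dimension is fixed by
rank-nullity; exactness means that it fills this kernel. This turns exactness into a maximal-rank
condition. -/
theorem exactInDegree_iff_finrank [Field K] [Finite σ] [Fintype ι] [DecidableEq ι]
    {f : ι → MvPolynomial σ K} {d : ℕ} (hf : ∀ i, (f i).IsHomogeneous d) (e : ℕ) :
    Module.finrank K (idealPiece f d (e + d)) + Module.finrank K (koszulPiece f d e) ≤
        Nat.card (ι × Exponent σ d (e + d)) ∧
    (ExactInDegree f e ↔
      Module.finrank K (idealPiece f d (e + d)) + Module.finrank K (koszulPiece f d e) =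
        Nat.card (ι × Exponent σ d (e + d))) := by
  have hle : koszulPiece f d e ≤
      LinearMap.ker ((Fintype.linearCombination (MvPolynomial σ K) f).restrictScalars K) ⊓
        Submodule.span K (Set.range (monomialTuple (σ := σ) (ι := ι) K d (e + d))) := by
    refine Submodule.span_le.2 ?_
    rintro _ ⟨⟨p, β, hβ⟩, rfl⟩
    refine ⟨?_, mem_span_monomialTuple.2 fun i => ?_⟩
    · rw [SetLike.mem_coe, LinearMap.mem_ker, LinearMap.restrictScalars_apply, map_smul,
        Fintype.linearCombination_apply]
      simp only [smul_eq_mul, sum_koszulSyzygy_mul, mul_zero]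
    · have := (isHomogeneous_monomial (1 : K) (rfl : β.degree = _)).mul
        (koszulSyzygy_apply_isHomogeneous hf p i)
      rwa [hβ] at this
  have hfin : Module.Finite K
      (Submodule.span K (Set.range (monomialTuple (σ := σ) (ι := ι) K d (e + d)))) :=
    Module.Finite.span_of_finite K (Set.finite_range _)
  have hfin' := Submodule.finiteDimensional_inf_right
    (LinearMap.ker ((Fintype.linearCombination (MvPolynomial σ K) f).restrictScalars K))
    (Submodule.span K (Set.range (monomialTuple (σ := σ) (ι := ι) K d (e + d))))
  rw [← finrank_idealPiece_add_finrank_ker f d e]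
  refine ⟨Nat.add_le_add_left (Submodule.finrank_mono hle) _, ?_⟩
  rw [Nat.add_left_cancel_iff]
  constructor
  · intro h
    refine congrArg (fun S : Submodule K (ι → MvPolynomial σ K) => Module.finrank K S) ?_
    refine le_antisymm hle fun a ha => ?_
    have hh := mem_span_monomialTuple.1 ha.2
    refine mem_koszulPiece hf hh (h a hh ?_)
    simpa [Fintype.linearCombination_apply] using ha.1
  · intro h a ha hsum
    have := Submodule.eq_of_le_of_finrank_eq hle h
    refine mem_span_of_mem_koszulPiece (d := d) (e := e) ?_
    rw [this]
    refine ⟨?_, mem_span_monomialTuple.2 ha⟩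
    simpa [Fintype.linearCombination_apply] using hsum

universe w

theorem exists_forall_finrank_idealPiece_le {D L : Type*} [CommRing D] [Field L] [Finite σ]
    [Finite ι] (F : ι → MvPolynomial σ D) (d j : ℕ) (φ : D →+* L) :
    ∃ P : D, φ P ≠ 0 ∧ ∀ (K : Type w) [Field K] (ψ : D →+* K), ψ P ≠ 0 →
      Module.finrank L (idealPiece (fun i => map φ (F i)) d j) ≤
        Module.finrank K (idealPiece (fun i => map ψ (F i)) d j) := by
  obtain ⟨P, hP, h⟩ := exists_forall_finrank_span_poly_le.{w}
    (fun p : ι × Exponent σ d j => monomial (p.2 : σ →₀ ℕ) (1 : D) * F p.1) φ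
  refine ⟨P, hP, fun K _ ψ hψ => ?_⟩
  have h1 : (fun p : ι × Exponent σ d j => map φ (monomial (p.2 : σ →₀ ℕ) 1 * F p.1)) =
      fun p => monomial (p.2 : σ →₀ ℕ) 1 * map φ (F p.1) :=
    funext fun p => by rw [map_mul, map_monomial, map_one]
  have h2 : (fun p : ι × Exponent σ d j => map ψ (monomial (p.2 : σ →₀ ℕ) 1 * F p.1)) =
      fun p => monomial (p.2 : σ →₀ ℕ) 1 * map ψ (F p.1) :=
    funext fun p => by rw [map_mul, map_monomial, map_one]
  have := h K ψ hψ
  rwa [h1, h2] at this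

/-- Openness of exactness, and constancy of the Hilbert function under deformations of exact
tuples. -/
theorem exists_forall_exactInDegree {D L : Type*} [CommRing D] [Field L] [Finite σ]
    [Fintype ι] [DecidableEq ι] (F : ι → MvPolynomial σ D) {d : ℕ}
    (hF : ∀ i, (F i).IsHomogeneous d) (φ : D →+* L) {e : ℕ}
    (hex : ExactInDegree (fun i => map φ (F i)) e) :
    ∃ P : D, φ P ≠ 0 ∧ ∀ (K : Type w) [Field K] (ψ : D →+* K), ψ P ≠ 0 →
      ExactInDegree (fun i => map ψ (F i)) e ∧
      Module.finrank K (idealPiece (fun i => map ψ (F i)) d (e + d)) =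
        Module.finrank L (idealPiece (fun i => map φ (F i)) d (e + d)) := by
  obtain ⟨P, hP, h⟩ := exists_forall_finrank_idealPiece_le.{w} F d (e + d) φ
  obtain ⟨Q, hQ, h'⟩ := exists_forall_finrank_span_tuple_le.{w}
    (fun p : (ι × ι) × Exponent σ d e => monomial (p.2 : σ →₀ ℕ) (1 : D) • koszulSyzygy F p.1) φ
  have hmap : ∀ {K : Type _} [Field K] (ψ : D →+* K), Submodule.span K
      (Set.range fun (p : (ι × ι) × Exponent σ d e) i =>
        map ψ ((monomial (p.2 : σ →₀ ℕ) (1 : D) • koszulSyzygy F p.1) i)) =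
      koszulPiece (fun i => map ψ (F i)) d e := by
    intro K _ ψ
    unfold koszulPiece
    congr 2
    funext p i
    simp [koszulSyzygy, map_monomial, Pi.single_apply, apply_ite (map ψ)]
  have hmap' : ∀ {K : Type w} [Field K] (ψ : D →+* K), Submodule.span K
      (Set.range fun (p : (ι × ι) × Exponent σ d e) i =>
        map ψ ((monomial (p.2 : σ →₀ ℕ) (1 : D) • koszulSyzygy F p.1) i)) =
      koszulPiece (fun i => map ψ (F i)) d e := by
    intro K _ ψ
    unfold koszulPiece
    congr 2
    funext p i
    simp [koszulSyzygy, map_monomial, Pi.single_apply, apply_ite (map ψ)]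
  -- Off the zero locus of `P * Q` neither rank drops, while their sum is already at its upper bound
  -- for `φ`. Hence both ranks stay the same.
  refine ⟨P * Q, by rw [map_mul]; exact mul_ne_zero hP hQ, fun K _ ψ hψ => ?_⟩
  rw [map_mul] at hψ
  have h1 := h K ψ (left_ne_zero_of_mul hψ)
  have h2 := h' K ψ (right_ne_zero_of_mul hψ)
  rw [hmap, hmap'] at h2
  have h3 := ((exactInDegree_iff_finrank (fun i => (hF i).map φ) e).2).1 hex
  have h4 := exactInDegree_iff_finrank (fun i => (hF i).map ψ) e
  have h5 := h4.1
  exact ⟨h4.2.2 (by omega), by omega⟩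

end GradedPieces

/-! ### Syzygies of pure powers of the variables -/

section MonomialCompleteIntersection

variable {σ K : Type*} [Field K]

theorem mem_span_X_pow_iff (d : ℕ) (s : Set σ) (p : MvPolynomial σ K) :
    p ∈ Ideal.span ((fun i => X i ^ d) '' s) ↔ ∀ m ∈ p.support, ∃ i ∈ s, d ≤ m i := by
  have h : ((fun i => X i ^ d) '' s : Set (MvPolynomial σ K)) =
      (fun m => monomial m 1) '' ((fun i => Finsupp.single i d) '' s) := by
    rw [Set.image_image]
    simp only [X_pow_eq_monomial]
  rw [h, mem_ideal_span_monomial_image]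
  simp [Finsupp.single_le_iff]

theorem mem_span_X_pow_of_mul_mem {d : ℕ} {s : Set σ} {i : σ} (hi : i ∉ s)
    {p : MvPolynomial σ K} (hp : p * X i ^ d ∈ Ideal.span ((fun i => X i ^ d) '' s)) :
    p ∈ Ideal.span ((fun i => X i ^ d) '' s) := by
  classical
  rw [mem_span_X_pow_iff] at hp ⊢
  intro m hm
  obtain ⟨j, hj, hle⟩ := hp (m + Finsupp.single i d) (by
    rw [mem_support_iff, X_pow_eq_monomial, coeff_mul_monomial, mul_one]
    exact mem_support_iff.1 hm)
  refine ⟨j, hj, ?_⟩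
  have hij : i ≠ j := fun h => hi (h ▸ hj)
  simpa [Finsupp.single_apply, hij] using hle

/-- Induction on a set containing the support of the syzygy. Since `X i₀ ^ d` is a nonzerodivisor
modulo the other powers, the entry at `i₀` lies in their ideal, and Koszul syzygies `(i, i₀)` clear
it. -/
theorem mem_span_koszulSyzygy_X_pow [Fintype σ] [DecidableEq σ] (d : ℕ) (s : Finset σ)
    (a : σ → MvPolynomial σ K) (hs : ∀ i ∉ s, a i = 0) (ha : ∑ i, a i * X i ^ d = 0) :
    a ∈ Submodule.span (MvPolynomial σ K) (Set.range (koszulSyzygy fun i => X i ^ d)) := by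
  induction s using Finset.induction_on generalizing a with
  | empty =>
    have : a = 0 := funext fun i => hs i (Finset.notMem_empty i)
    rw [this]
    exact Submodule.zero_mem _
  | insert i₀ s hi₀ ih =>
    have h1 : ∑ i ∈ insert i₀ s, a i * X i ^ d = 0 := by
      rw [← ha]
      refine Finset.sum_subset (Finset.subset_univ _) fun i _ hi => ?_
      rw [hs i hi, zero_mul]
    rw [Finset.sum_insert hi₀] at h1
    have h2 : a i₀ ∈ Ideal.span ((fun i => (X i : MvPolynomial σ K) ^ d) '' (s : Set σ)) := by
      refine mem_span_X_pow_of_mul_mem (i := i₀) (by simpa using hi₀) ?_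
      rw [eq_neg_of_add_eq_zero_left h1]
      refine neg_mem (Ideal.sum_mem _ fun i hi => Ideal.mul_mem_left _ _ (Ideal.subset_span ?_))
      exact ⟨i, hi, rfl⟩
    obtain ⟨b, hb⟩ : ∃ b : σ → MvPolynomial σ K, ∑ i ∈ s, b i * X i ^ d = a i₀ := by
      obtain ⟨b, hb⟩ := (Submodule.mem_span_image_finset_iff_exists_fun _).1 h2
      refine ⟨fun i => if h : i ∈ s then b ⟨i, h⟩ else 0, ?_⟩
      rw [← hb, ← Finset.sum_attach s]
      exact Finset.sum_congr rfl fun i _ => by simp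
    have hkos : ∑ i ∈ s, b i • koszulSyzygy (fun i => (X i : MvPolynomial σ K) ^ d) (i, i₀) ∈
        Submodule.span (MvPolynomial σ K) (Set.range (koszulSyzygy fun i => X i ^ d)) :=
      Submodule.sum_mem _ fun i _ =>
        Submodule.smul_mem _ _ (Submodule.subset_span (Set.mem_range_self _))
    rw [← sub_add_cancel a
      (∑ i ∈ s, b i • koszulSyzygy (fun i => (X i : MvPolynomial σ K) ^ d) (i, i₀))]
    refine Submodule.add_mem _ (ih _ (fun i hi => ?_) ?_) hkos
    · by_cases hii : i = i₀
      · subst hii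
        have : ∀ j ∈ s, i ≠ j := fun j hj h => hi₀ (h ▸ hj)
        rw [Pi.sub_apply, Finset.sum_apply, ← hb, sub_eq_zero]
        refine Finset.sum_congr rfl fun j hj => ?_
        simp [koszulSyzygy, this j hj]
      · have hne : ∀ j ∈ s, i ≠ j := fun j hj h => hi (h ▸ hj)
        rw [Pi.sub_apply, hs i (by simp [hii, hi]), Finset.sum_apply, zero_sub, neg_eq_zero]
        refine Finset.sum_eq_zero fun j hj => ?_
        simp [koszulSyzygy, hne j hj, hii]
    · simp only [Pi.sub_apply, sub_mul, Finset.sum_sub_distrib, ha, zero_sub, neg_eq_zero,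
        Finset.sum_apply, Pi.smul_apply, smul_eq_mul, Finset.sum_mul]
      rw [Finset.sum_comm]
      refine Finset.sum_eq_zero fun i _ => ?_
      simp only [mul_assoc, ← Finset.mul_sum]
      rw [sum_koszulSyzygy_mul (fun i => (X i : MvPolynomial σ K) ^ d) (i, i₀), mul_zero]

theorem exactInDegree_X_pow [Fintype σ] [DecidableEq σ] (d e : ℕ) :
    ExactInDegree (fun i : σ => (X i : MvPolynomial σ K) ^ d) e := fun a _ ha =>
  mem_span_koszulSyzygy_X_pow d Finset.univ a (fun i hi => absurd (Finset.mem_univ i) hi) ha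

end MonomialCompleteIntersection

/-! ### The strong Lefschetz property via an `sl₂` lowering operator -/

section Lefschetz

variable {σ K : Type*} [Field K] [Fintype σ]

/-- The lowering operator `∑ i, ((d - 1) ∂ᵢ - Xᵢ ∂ᵢ²)`. -/
def lowering (d : ℕ) (p : MvPolynomial σ K) : MvPolynomial σ K :=
  ∑ i, (((d : MvPolynomial σ K) - 1) * pderiv i p - X i * pderiv i (pderiv i p))

theorem lowering_add (d : ℕ) (p q : MvPolynomial σ K) :
    lowering d (p + q) = lowering d p + lowering d q := by
  simp only [lowering, map_add, ← Finset.sum_add_distrib]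
  exact Finset.sum_congr rfl fun i _ => by ring

theorem lowering_isHomogeneous {d e : ℕ} {p : MvPolynomial σ K} (hp : p.IsHomogeneous (e + 1)) :
    (lowering d p).IsHomogeneous e := by
  refine IsHomogeneous.sum _ _ _ fun i _ => ?_
  have h1 : (pderiv i p).IsHomogeneous e := hp.pderiv
  refine IsHomogeneous.sub ?_ ?_
  · have := (isHomogeneous_C σ ((d : K) - 1)).mul h1
    simpa using this
  · rcases e with _ | e
    · rw [totalDegree_eq_zero_iff_eq_C.1 ((totalDegree_zero_iff_isHomogeneous _).2 h1)]
      simpa using isHomogeneous_zero σ K 0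
    · have := (isHomogeneous_X K i).mul (h1.pderiv (i := i))
      rwa [Nat.add_sub_cancel, add_comm 1] at this

theorem lowering_eq_zero {d : ℕ} {p : MvPolynomial σ K} (hp : p.IsHomogeneous 0) :
    lowering d p = 0 := by
  rw [totalDegree_eq_zero_iff_eq_C.1 ((totalDegree_zero_iff_isHomogeneous _).2 hp)]
  simp [lowering]

/-- In one variable the operator sends `x^a` to `a(d-a)x^(a-1)`. The coefficient vanishes at `a =
d`, the only exponent at which the ideal `(x^d)` could be left, so the operator descends to the
quotient. -/
theorem lowering_mem {d : ℕ} {p : MvPolynomial σ K}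
    (hp : p ∈ Ideal.span (Set.range fun i : σ => (X i : MvPolynomial σ K) ^ d)) :
    lowering d p ∈ Ideal.span (Set.range fun i : σ => (X i : MvPolynomial σ K) ^ d) := by
  classical
  obtain ⟨c, rfl⟩ := Ideal.mem_span_range_iff_exists_fun.1 hp
  have key : ∀ s : Finset σ, lowering d (∑ i ∈ s, c i * X i ^ d) ∈
      Ideal.span (Set.range fun i : σ => (X i : MvPolynomial σ K) ^ d) := by
    intro s
    induction s using Finset.induction_on with
    | empty => simp [lowering]
    | insert i s hi ih =>
      rw [Finset.sum_insert hi, lowering_add]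
      refine Ideal.add_mem _ (Ideal.sum_mem _ fun l _ => ?_) ih
      have hX : (X i : MvPolynomial σ K) ^ d ∈
          Ideal.span (Set.range fun i : σ => (X i : MvPolynomial σ K) ^ d) :=
        Ideal.subset_span ⟨i, rfl⟩
      by_cases hl : l = i
      · subst hl
        -- The second derivative of `X ^ d` involves the exponent `d - 2`, so `d = 0` (unit ideal)
        -- and `d = 1` are separated.
        rcases d with _ | _ | d
        · rw [pow_zero] at hX
          rw [(Ideal.eq_top_iff_one _).2 hX]
          exact Submodule.mem_top
        · simp only [zero_add, pow_one, pderiv_mul, pderiv_X_self, map_add] at hX ⊢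
          refine (Ideal.mem_span_singleton.2 ?_ : _ ∈ Ideal.span {X l}) |> fun h =>
            ((Ideal.span_singleton_le_iff_mem _).2 hX) h
          exact ⟨- (pderiv l (pderiv l (c l)) * X l + pderiv l (c l) + pderiv l (c l)), by
            simp; ring⟩
        · refine (Ideal.mem_span_singleton.2 ?_ : _ ∈ Ideal.span {X l ^ (d + 1 + 1)}) |> fun h =>
            ((Ideal.span_singleton_le_iff_mem _).2 hX) h
          refine ⟨((d : MvPolynomial σ K) + 1) * pderiv l (c l) -
            X l * pderiv l (pderiv l (c l)) - 2 * ((d : MvPolynomial σ K) + 2) * pderiv l (c l), ?_⟩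
          simp
          ring
      · have h0 : pderiv l ((X i : MvPolynomial σ K) ^ d) = 0 := by
          rw [pderiv_pow, pderiv_X_of_ne (Ne.symm hl), mul_zero]
        have h1 : ∀ r : MvPolynomial σ K, pderiv l (r * X i ^ d) = pderiv l r * X i ^ d := by
          intro r
          rw [pderiv_mul, h0, mul_zero, add_zero]
        rw [h1, h1, ← mul_assoc, ← mul_assoc, ← sub_mul]
        exact Ideal.mul_mem_left _ _ hX
  exact key Finset.univ

/-- The `sl₂` commutation relation: by Euler's formula, the commutator of the operator with
multiplication by `ℓ` is the scalar weight in each degree. -/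
theorem lowering_sum_X_mul {d e : ℕ} {p : MvPolynomial σ K} (hp : p.IsHomogeneous e) :
    lowering d ((∑ i, X i) * p) = (∑ i, X i) * lowering d p +
      ((Fintype.card σ : MvPolynomial σ K) * ((d : MvPolynomial σ K) - 1) -
        2 * (e : MvPolynomial σ K)) * p := by
  classical
  have hX : ∀ i : σ, pderiv i (∑ i, X i : MvPolynomial σ K) = 1 := by
    intro i
    simp [map_sum, pderiv_X, Pi.single_apply]
  have heuler : ∑ i, X i * pderiv i p = (e : MvPolynomial σ K) * p := by
    rw [hp.sum_X_mul_pderiv, nsmul_eq_mul]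
  have h1 : ∀ i : σ, ((d : MvPolynomial σ K) - 1) * pderiv i ((∑ i, X i) * p) -
      X i * pderiv i (pderiv i ((∑ i, X i) * p)) =
      (∑ i, X i) * (((d : MvPolynomial σ K) - 1) * pderiv i p - X i * pderiv i (pderiv i p)) +
      (((d : MvPolynomial σ K) - 1) * p - 2 * (X i * pderiv i p)) := by
    intro i
    simp only [pderiv_mul, hX, map_add, one_mul]
    ring
  rw [lowering, Finset.sum_congr rfl fun i _ => h1 i, Finset.sum_add_distrib, ← Finset.mul_sum,
    Finset.sum_sub_distrib (f := fun _ => ((d : MvPolynomial σ K) - 1) * p), ← Finset.mul_sum,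
    ← Finset.mul_sum, heuler, Finset.sum_const, Finset.card_univ,
    nsmul_eq_mul]
  simp only [lowering]
  ring

theorem lowering_sum_X_pow_mul {d e : ℕ} {p : MvPolynomial σ K} (hp : p.IsHomogeneous e) (m : ℕ) :
    lowering d ((∑ i, X i) ^ (m + 1) * p) = (∑ i, X i) ^ (m + 1) * lowering d p +
      (((m : MvPolynomial σ K) + 1) * ((Fintype.card σ : MvPolynomial σ K) *
        ((d : MvPolynomial σ K) - 1) - 2 * (e : MvPolynomial σ K) - (m : MvPolynomial σ K))) *
        ((∑ i, X i) ^ m * p) := by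
  induction m with
  | zero =>
    rw [zero_add, pow_one, lowering_sum_X_mul hp]
    simp
  | succ m ih =>
    have hℓ : (∑ i, X i : MvPolynomial σ K).IsHomogeneous 1 :=
      IsHomogeneous.sum _ _ _ fun i _ => isHomogeneous_X K i
    have := lowering_sum_X_mul (d := d) ((hℓ.pow (m + 1)).mul hp)
    rw [pow_succ' _ (m + 1), mul_assoc, this, ih]
    push_cast
    ring

/-- The strong Lefschetz property of monomial complete intersections in characteristic zero. -/
theorem mem_of_sum_X_pow_mul_mem [CharZero K] {d : ℕ} (e m : ℕ) (p : MvPolynomial σ K)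
    (hp : p.IsHomogeneous e) (hm : (m : ℤ) + 2 * e ≤ Fintype.card σ * ((d : ℤ) - 1))
    (hmem : (∑ i, X i) ^ m * p ∈
      Ideal.span (Set.range fun i : σ => (X i : MvPolynomial σ K) ^ d)) :
    p ∈ Ideal.span (Set.range fun i : σ => (X i : MvPolynomial σ K) ^ d) := by
  set J := Ideal.span (Set.range fun i : σ => (X i : MvPolynomial σ K) ^ d)
  -- Lower `ℓ^(m+1) p` and multiply by `ℓ`: the correction term is a multiple of `ℓ^(m+1) p`, which
  -- is already in `J`.
  have step : ∀ (e m : ℕ) (p : MvPolynomial σ K), p.IsHomogeneous e →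
      (∑ i, X i) ^ (m + 1) * p ∈ J → (∑ i, X i) ^ (m + 2) * lowering d p ∈ J := by
    intro e m p hp hmem
    have h1 := lowering_sum_X_pow_mul (d := d) hp m
    have h2 := J.mul_mem_left (∑ i, X i) (lowering_mem hmem)
    rw [h1, mul_add] at h2
    refine (Ideal.add_mem_iff_left J (J.mul_mem_left (((m : MvPolynomial σ K) + 1) *
      ((Fintype.card σ : MvPolynomial σ K) * ((d : MvPolynomial σ K) - 1) -
        2 * (e : MvPolynomial σ K) - (m : MvPolynomial σ K))) hmem)).1 ?_
    convert h2 using 1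
    ring
  -- Once the lowering of `p` is known to be in `J`, lowering `ℓ^(m+1) p` leaves a scalar multiple
  -- of `ℓ^m p` in `J`. The degree bound and characteristic zero make that scalar nonzero, so the
  -- powers of `ℓ` come off one by one.
  have descent : ∀ (e : ℕ) (p : MvPolynomial σ K), p.IsHomogeneous e →
      (∀ m : ℕ, ((m + 1 : ℕ) : ℤ) + 2 * e ≤ Fintype.card σ * ((d : ℤ) - 1) →
        (∑ i, X i) ^ (m + 1) * p ∈ J → lowering d p ∈ J) →
      ∀ m : ℕ, (m : ℤ) + 2 * e ≤ Fintype.card σ * ((d : ℤ) - 1) →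
        (∑ i, X i) ^ m * p ∈ J → p ∈ J := by
    intro e p hp hlow m
    induction m with
    | zero => simp
    | succ m ihm =>
      intro hm hmem
      refine ihm (by push_cast at hm; omega) ?_
      have h2 := lowering_mem hmem
      rw [lowering_sum_X_pow_mul hp m, Ideal.add_mem_iff_right J
        (J.mul_mem_left _ (hlow m hm hmem))] at h2
      set z : ℤ := ((m : ℤ) + 1) * (Fintype.card σ * ((d : ℤ) - 1) - 2 * e - m) with hz
      have hz0 : (z : K) ≠ 0 := by
        rw [Int.cast_ne_zero, hz]
        push_cast at hm
        exact mul_ne_zero (by omega) (by omega)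
      have hzC : (((m : MvPolynomial σ K) + 1) * ((Fintype.card σ : MvPolynomial σ K) *
          ((d : MvPolynomial σ K) - 1) - 2 * (e : MvPolynomial σ K) - (m : MvPolynomial σ K))) =
          C (z : K) := by
        rw [map_intCast, hz]
        push_cast
        ring
      rw [hzC] at h2
      have h3 := J.mul_mem_left (C (z : K)⁻¹) h2
      rwa [← mul_assoc, ← C_mul, inv_mul_cancel₀ hz0, C_1, one_mul] at h3
  induction e generalizing m p with
  | zero =>
    refine descent 0 p hp (fun m _ _ => ?_) m hm hmem
    rw [lowering_eq_zero hp]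
    exact J.zero_mem
  | succ e ih =>
    refine descent (e + 1) p hp (fun m hm hmem => ?_) m hm hmem
    exact ih (m + 2) _ (lowering_isHomogeneous hp) (by push_cast at hm ⊢; omega)
      (step (e + 1) m p hp hmem)

end Lefschetz

/-! ### Symmetry and strict unimodality of the Hilbert function of `(X_1^d, …, X_n^d)` -/

section BoundedCompositions

/-- The number of `n`-tuples of integers in `[0, d)` with sum `i`. -/
def boundedCount (d n : ℕ) (i : ℤ) : ℕ :=
  (Finset.univ.filter fun g : Fin n → Fin d => ∑ l, ((g l : ℕ) : ℤ) = i).card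

theorem boundedCount_zero (d : ℕ) (i : ℤ) : boundedCount d 0 i = if i = 0 then 1 else 0 := by
  simp only [boundedCount, Finset.univ_eq_empty, Finset.sum_empty]
  split_ifs with h
  · simp [h]
  · simp [Ne.symm h]

theorem boundedCount_succ (d n : ℕ) (i : ℤ) :
    boundedCount d (n + 1) i = ∑ a ∈ Finset.range d, boundedCount d n (i - a) := by
  simp only [boundedCount, Finset.card_filter]
  rw [← (Fin.consEquiv fun _ : Fin (n + 1) => Fin d).sum_comp, Fintype.sum_prod_type,
    ← Fin.sum_univ_eq_sum_range (fun a => ∑ g : Fin n → Fin d,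
      if ∑ l, ((g l : ℕ) : ℤ) = i - a then 1 else 0)]
  refine Finset.sum_congr rfl fun a _ => Finset.sum_congr rfl fun g _ => ?_
  simp [Fin.consEquiv, Fin.sum_univ_succ, eq_sub_iff_add_eq, add_comm]

theorem boundedCount_symm (d n : ℕ) (i : ℤ) :
    boundedCount d n (n * ((d : ℤ) - 1) - i) = boundedCount d n i := by
  refine Finset.card_equiv (Equiv.arrowCongr (Equiv.refl _) Fin.revPerm) fun g => ?_
  have : ∀ l, ((((Equiv.arrowCongr (Equiv.refl (Fin n)) Fin.revPerm) g l : Fin d) : ℕ) : ℤ) =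
      (d : ℤ) - 1 - (g l : ℕ) := by
    intro l
    have := (g l).isLt
    simp [Fin.val_rev]
    omega
  simp only [Finset.mem_filter, Finset.mem_univ, true_and, this, Finset.sum_sub_distrib,
    Finset.sum_const, Finset.card_univ, Fintype.card_fin, nsmul_eq_mul]
  constructor <;> intro h <;> linarith

theorem boundedCount_of_neg (d n : ℕ) {i : ℤ} (hi : i < 0) : boundedCount d n i = 0 := by
  rw [boundedCount, Finset.card_eq_zero, Finset.filter_eq_empty_iff]
  intro g _ h
  have : 0 ≤ ∑ l, ((g l : ℕ) : ℤ) := Finset.sum_nonneg fun _ _ => Int.natCast_nonneg _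
  omega

/-- Sliding the window of `d` summands in `boundedCount_succ` by one: consecutive differences for `n
+ 1` parts are differences at distance `d` for `n` parts. -/
theorem boundedCount_succ_add (d n : ℕ) (i : ℤ) :
    boundedCount d (n + 1) i + boundedCount d n (i - d) =
      boundedCount d (n + 1) (i - 1) + boundedCount d n i := by
  have h1 := Finset.sum_range_succ (fun a : ℕ => boundedCount d n (i - a)) d
  have h2 := Finset.sum_range_succ' (fun a : ℕ => boundedCount d n (i - a)) d
  rw [boundedCount_succ, boundedCount_succ, ← h1, h2]
  simp [sub_sub, add_comm]

theorem boundedCount_one {d : ℕ} {i : ℤ} (h0 : 0 ≤ i) (hi : i < d) : boundedCount d 1 i = 1 := by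
  rw [boundedCount_succ, Finset.sum_eq_single i.toNat]
  · rw [boundedCount_zero, if_pos (by omega)]
  · intro b _ hb
    rw [boundedCount_zero, if_neg (by omega)]
  · intro h
    exact absurd (Finset.mem_range.2 (by omega)) h

/-- If `j` is past the middle it is replaced by its mirror image; `i` lies below both, so the
increasing steps of the first half chain up from `i`. -/
theorem boundedCount_lt_of_step {d n : ℕ}
    (step : ∀ j : ℤ, 0 ≤ j → 2 * j ≤ n * ((d : ℤ) - 1) →
      boundedCount d n (j - 1) < boundedCount d n j)
    {i j : ℤ} (h0 : 0 ≤ j) (hj : j ≤ n * ((d : ℤ) - 1)) (hij : i < j)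
    (hij' : i < n * ((d : ℤ) - 1) - j) : boundedCount d n i < boundedCount d n j := by
  have mono : ∀ (t : ℕ) (j : ℤ), 0 ≤ j → 2 * j ≤ n * ((d : ℤ) - 1) →
      boundedCount d n (j - 1 - t) < boundedCount d n j := by
    intro t
    induction t with
    | zero => simpa using step
    | succ t ih =>
      intro j h0 hj
      rcases h0.eq_or_lt with rfl | h0
      · rw [boundedCount_of_neg d n (by push_cast; omega)]
        exact (Nat.zero_le _).trans_lt (step 0 le_rfl hj)
      · have := ih (j - 1) (by omega) (by omega)
        refine lt_trans ?_ (step j h0.le hj)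
        rwa [show j - 1 - ((t + 1 : ℕ) : ℤ) = j - 1 - 1 - t by push_cast; ring]
  have main : ∀ j : ℤ, 0 ≤ j → 2 * j ≤ n * ((d : ℤ) - 1) → i < j →
      boundedCount d n i < boundedCount d n j := by
    intro j h0 hj hij
    have := mono (j - 1 - i).toNat j h0 hj
    rwa [show j - 1 - ((j - 1 - i).toNat : ℤ) = i by omega] at this
  by_cases h : 2 * j ≤ n * ((d : ℤ) - 1)
  · exact main j h0 h hij
  · rw [← boundedCount_symm d n j]
    exact main _ (by omega) (by omega) hij'

/-- Strict unimodality. -/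
theorem boundedCount_pred_lt {d : ℕ} (hd : 1 ≤ d) (n : ℕ) (j : ℤ) (h0 : 0 ≤ j)
    (hj : 2 * j ≤ ((n + 2 : ℕ) : ℤ) * ((d : ℤ) - 1)) :
    boundedCount d (n + 2) (j - 1) < boundedCount d (n + 2) j := by
  induction n generalizing j with
  -- The induction starts at two parts: for one part the counts are constant on `[0, d)`, so
  -- strictness fails when `d ≥ 3`.
  | zero =>
    have h := boundedCount_succ_add d 1 j
    push_cast at hj
    rw [boundedCount_one h0 (by omega), boundedCount_of_neg d 1 (by omega)] at h
    exact (by omega : boundedCount d (1 + 1) (j - 1) < boundedCount d (1 + 1) j)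
  | succ n ih =>
    have h := boundedCount_succ_add d (n + 2) j
    have h1 : (0 : ℤ) ≤ (n : ℤ) * ((d : ℤ) - 1) := mul_nonneg (by omega) (by omega)
    -- By the recurrence this is the required step for `n + 3` parts. The bound on `j` puts `j - d`
    -- below the mirror image of `j`.
    have h2 : boundedCount d (n + 2) (j - d) < boundedCount d (n + 2) j := by
      refine boundedCount_lt_of_step ih h0 ?_ (by omega) ?_
      · push_cast at hj ⊢
        nlinarith
      · push_cast at hj ⊢
        nlinarith
    have h3 : n + 1 + 2 = n + 2 + 1 := by ring
    rw [h3]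
    omega

/-- Since `2e ≥ (n-1)(d-1)`, the mirror image `n(d-1) - (e+d)` of `e + d` is less than `e`; it is
also less than `n(d-1) - e`. -/
theorem boundedCount_add_lt {d n e : ℕ} (hd : 1 ≤ d) (hn : 2 ≤ n)
    (he : e = ((n - 1) * (d - 1) + 1) / 2) :
    boundedCount d n ((e : ℤ) + d) < boundedCount d n e := by
  obtain ⟨n, rfl⟩ := Nat.exists_eq_add_of_le' hn
  obtain ⟨d, rfl⟩ := Nat.exists_eq_add_of_le' hd
  rw [← boundedCount_symm]
  have h1 : n + 2 - 1 = n + 1 := rfl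
  rw [h1, Nat.add_sub_cancel] at he
  have h2 : (n + 1) * d = n * d + d := by ring
  rw [h2] at he
  have h3 : ((n + 2 : ℕ) : ℤ) * (((d + 1 : ℕ) : ℤ) - 1) = ((n * d : ℕ) : ℤ) + 2 * d := by
    push_cast; ring
  have h5 : d = 0 → n * d = 0 := by
    rintro rfl
    simp
  refine boundedCount_lt_of_step (boundedCount_pred_lt hd n) ?_ ?_ ?_ ?_
  all_goals
    try rw [h3]
    generalize n * d = N at *
    push_cast
    omega

end BoundedCompositions

/-! ### Dimensions of the graded pieces by counting monomials -/

section Dimensions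

theorem finrank_span_monomial {σ : Type*} (K : Type*) [Field K] (p : (σ →₀ ℕ) → Prop)
    [Finite {β // p β}] :
    Module.finrank K (Submodule.span K
      (Set.range fun β : {β : σ →₀ ℕ // p β} => monomial (β : σ →₀ ℕ) (1 : K))) =
      Nat.card {β // p β} := by
  have := Fintype.ofFinite {β // p β}
  have h := (basisMonomials σ K).linearIndependent.comp
    (fun β : {β : σ →₀ ℕ // p β} => (β : σ →₀ ℕ)) Subtype.val_injective
  rw [coe_basisMonomials] at h
  rw [Nat.card_eq_fintype_card]
  exact finrank_span_eq_card h

instance {σ : Type*} [Finite σ] (j : ℕ) : Finite {β : σ →₀ ℕ // β.degree = j} :=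
  (Finsupp.finite_of_degree_eq j).to_subtype

theorem homogeneousSubmodule_eq_span (σ K : Type*) [Field K] (j : ℕ) :
    homogeneousSubmodule σ K j = Submodule.span K
      (Set.range fun β : {β : σ →₀ ℕ // β.degree = j} => monomial (β : σ →₀ ℕ) (1 : K)) := by
  refine le_antisymm (fun p hp => ?_) (Submodule.span_le.2 ?_)
  · rw [as_sum p]
    refine Submodule.sum_mem _ fun β hβ => ?_
    rw [← mul_one (coeff β p), ← smul_eq_mul, ← smul_monomial]
    refine Submodule.smul_mem _ _ (Submodule.subset_span ⟨⟨β, ?_⟩, rfl⟩)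
    by_contra h
    exact (mem_support_iff.1 hβ) (IsHomogeneous.coeff_eq_zero hp h)
  · rintro _ ⟨β, rfl⟩
    exact isHomogeneous_monomial _ β.2

instance finite_homogeneousSubmodule (σ K : Type*) [Finite σ] [Field K] (j : ℕ) :
    Module.Finite K (homogeneousSubmodule σ K j) := by
  rw [homogeneousSubmodule_eq_span]
  exact Module.Finite.span_of_finite K (Set.finite_range _)

theorem finrank_homogeneousSubmodule (σ K : Type*) [Finite σ] [Field K] (j : ℕ) :
    Module.finrank K (homogeneousSubmodule σ K j) = Nat.card {β : σ →₀ ℕ // β.degree = j} := by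
  rw [homogeneousSubmodule_eq_span, finrank_span_monomial]

theorem idealPiece_X_pow_eq_span (σ K : Type*) [Field K] (d j : ℕ) :
    idealPiece (fun i : σ => (X i : MvPolynomial σ K) ^ d) d j = Submodule.span K
      (Set.range fun β : {β : σ →₀ ℕ // β.degree = j ∧ ∃ i, d ≤ β i} =>
        monomial (β : σ →₀ ℕ) (1 : K)) := by
  unfold idealPiece
  congr 1
  ext p
  constructor
  · rintro ⟨⟨i, β, hβ⟩, rfl⟩
    refine ⟨⟨β + Finsupp.single i d, ?_, i, by simp⟩, ?_⟩
    · rw [map_add, Finsupp.degree_single, hβ]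
    · simp [X_pow_eq_monomial, monomial_mul]
  · rintro ⟨⟨β, hβ, i, hi⟩, rfl⟩
    have h : β - Finsupp.single i d + Finsupp.single i d = β :=
      tsub_add_cancel_of_le (Finsupp.single_le_iff.2 hi)
    refine ⟨⟨i, β - Finsupp.single i d, ?_⟩, ?_⟩
    · conv_rhs => rw [← hβ, ← h, map_add, Finsupp.degree_single]
    · simp [X_pow_eq_monomial, monomial_mul, h]

theorem card_bounded_exponents (d n j : ℕ) :
    Nat.card {β : Fin n →₀ ℕ // β.degree = j ∧ ¬ ∃ i, d ≤ β i} = boundedCount d n j := by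
  rw [boundedCount, ← Fintype.card_subtype, ← Nat.card_eq_fintype_card]
  refine Nat.card_congr
    { toFun := fun β => ⟨fun l => ⟨β.1 l, by
        have := β.2.2
        push Not at this
        exact this l⟩, ?_⟩
      invFun := fun g => ⟨Finsupp.equivFunOnFinite.symm fun l => (g.1 l : ℕ), ?_, ?_⟩
      left_inv := fun β => ?_
      right_inv := fun g => ?_ }
  · have := β.2.1
    rw [Finsupp.degree_eq_sum] at this
    exact_mod_cast this
  · have := g.2
    rw [Finsupp.degree_eq_sum]
    simp only [Finsupp.equivFunOnFinite_symm_apply_apply]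
    exact_mod_cast this
  · simp
  · ext
    simp
  · ext
    simp

theorem finrank_idealPiece_X_pow (K : Type*) [Field K] (d n j : ℕ) :
    Module.finrank K (idealPiece (fun i : Fin n => (X i : MvPolynomial (Fin n) K) ^ d) d j) +
      boundedCount d n j = Module.finrank K (homogeneousSubmodule (Fin n) K j) := by
  have e1 := Equiv.subtypeSubtypeEquivSubtypeInter (fun β : Fin n →₀ ℕ => β.degree = j)
    (fun β => ∃ i, d ≤ β i)
  have e2 := Equiv.subtypeSubtypeEquivSubtypeInter (fun β : Fin n →₀ ℕ => β.degree = j)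
    (fun β => ¬ ∃ i, d ≤ β i)
  have : Finite {β : Fin n →₀ ℕ // β.degree = j ∧ ∃ i, d ≤ β i} := Finite.of_equiv _ e1
  rw [idealPiece_X_pow_eq_span, finrank_span_monomial, finrank_homogeneousSubmodule,
    ← card_bounded_exponents, ← Nat.card_congr e1, ← Nat.card_congr e2, ← Nat.card_sum]
  classical
  exact Nat.card_congr (Equiv.sumCompl _)

end Dimensions

/-! ### A dimension drop forces a non-Koszul syzygy -/

section NonExactness

theorem exists_of_mem_idealPiece {σ K ι : Type*} [Field K] [Fintype ι]
    {f : ι → MvPolynomial σ K} {d e : ℕ} {p : MvPolynomial σ K}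
    (hp : p ∈ idealPiece f d (e + d)) :
    ∃ a : ι → MvPolynomial σ K, (∀ i, (a i).IsHomogeneous e) ∧ ∑ i, a i * f i = p := by
  classical
  induction hp using Submodule.span_induction with
  | mem x hx =>
    obtain ⟨⟨i, β, hβ⟩, rfl⟩ := hx
    refine ⟨Pi.single i (monomial β 1), fun l => ?_, by simp [Pi.single_apply]⟩
    by_cases h : l = i
    · subst h
      rw [Pi.single_eq_same]
      exact isHomogeneous_monomial _ (by omega)
    · rw [Pi.single_eq_of_ne h]
      exact isHomogeneous_zero _ _ _
  | zero => exact ⟨0, fun i => isHomogeneous_zero _ _ _, by simp⟩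
  | add x y _ _ hx hy =>
    obtain ⟨a, ha, rfl⟩ := hx
    obtain ⟨b, hb, rfl⟩ := hy
    exact ⟨a + b, fun i => (ha i).add (hb i), by simp [add_mul, Finset.sum_add_distrib]⟩
  | smul c x _ hx =>
    obtain ⟨a, ha, rfl⟩ := hx
    refine ⟨c • a, fun i => ?_, by simp [Finset.smul_sum]⟩
    exact (homogeneousSubmodule σ K e).smul_mem c (ha i)

/-- The zeroth entry of a generating Koszul syzygy is zero or, up to sign, one of the other `h
l.succ`. -/
theorem apply_zero_mem_of_mem_span_koszulSyzygy {R : Type*} [CommRing R] {n : ℕ}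
    {h : Fin (n + 1) → R} {a : Fin (n + 1) → R}
    (ha : a ∈ Submodule.span R (Set.range (koszulSyzygy h))) :
    a 0 ∈ Ideal.span (Set.range fun l : Fin n => h l.succ) := by
  have : Submodule.span R (Set.range (koszulSyzygy h)) ≤
      Submodule.comap (LinearMap.proj (R := R) (φ := fun _ : Fin (n + 1) => R) 0)
        (Ideal.span (Set.range fun l : Fin n => h l.succ)) := by
    refine Submodule.span_le.2 ?_
    rintro _ ⟨⟨i, j⟩, rfl⟩
    have hmem : ∀ l : Fin n, h l.succ ∈ Ideal.span (Set.range fun l : Fin n => h l.succ) :=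
      fun l => Ideal.subset_span ⟨l, rfl⟩
    induction i using Fin.cases <;> induction j using Fin.cases <;>
      simp [koszulSyzygy, hmem, (Fin.succ_ne_zero _).symm]
  exact this ha

theorem exists_apply_mem_and_notMem_of_finrank {K M : Type*} [Field K] [AddCommGroup M]
    [Module K M] (T : M →ₗ[K] M) {V W I I₀ : Submodule K M} [Module.Finite K V]
    [Module.Finite K W] (hT : ∀ p ∈ V, T p ∈ W) (hI : I ≤ W) (hI₀ : I₀ ≤ V) {c c' : ℕ}
    (h1 : Module.finrank K I₀ + c = Module.finrank K V)
    (h2 : Module.finrank K I + c' = Module.finrank K W) (hc : c' < c) :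
    ∃ p ∈ V, T p ∈ I ∧ p ∉ I₀ := by
  let T' : V →ₗ[K] W ⧸ I.submoduleOf W := (I.submoduleOf W).mkQ ∘ₗ T.restrict hT
  have hq := Submodule.finrank_quotient_add_finrank (I.submoduleOf W)
  rw [LinearEquiv.finrank_eq (Submodule.submoduleOfEquivOfLe hI), ← h2] at hq
  have hrn := LinearMap.finrank_range_add_finrank_ker T'
  have hle := Submodule.finrank_le (LinearMap.range T')
  by_contra! hcon
  have hle' : LinearMap.ker T' ≤ I₀.submoduleOf V := by
    intro p hp
    rw [LinearMap.mem_ker, LinearMap.comp_apply, Submodule.mkQ_apply,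
      Submodule.Quotient.mk_eq_zero] at hp
    exact hcon p p.2 hp
  have := Submodule.finrank_mono hle'
  rw [LinearEquiv.finrank_eq (Submodule.submoduleOfEquivOfLe hI₀)] at this
  omega

/-- Multiplication by `h 0` on the quotient by the other forms cannot be injective if the
dimension drops. -/
theorem not_exactInDegree_of_finrank {K : Type*} [Field K] {n d e c c' : ℕ}
    {h : Fin (n + 1) → MvPolynomial (Fin n) K} (hh : ∀ i, (h i).IsHomogeneous d)
    (h1 : Module.finrank K (idealPiece (fun l : Fin n => h l.succ) d e) + c =
      Module.finrank K (homogeneousSubmodule (Fin n) K e))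
    (h2 : Module.finrank K (idealPiece (fun l : Fin n => h l.succ) d (e + d)) + c' =
      Module.finrank K (homogeneousSubmodule (Fin n) K (e + d)))
    (hc : c' < c) : ¬ ExactInDegree h e := by
  intro hex
  have key : ∃ p : MvPolynomial (Fin n) K, p.IsHomogeneous e ∧
      p * h 0 ∈ idealPiece (fun l : Fin n => h l.succ) d (e + d) ∧
      p ∉ idealPiece (fun l : Fin n => h l.succ) d e := exists_apply_mem_and_notMem_of_finrank
    (LinearMap.mulRight K (h 0)) (V := homogeneousSubmodule (Fin n) K e)
    (W := homogeneousSubmodule (Fin n) K (e + d)) (fun p hp => IsHomogeneous.mul hp (hh 0))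
    (idealPiece_le_homogeneousSubmodule (f := fun l : Fin n => h l.succ)
      (fun l => hh l.succ) (e + d))
    (idealPiece_le_homogeneousSubmodule (f := fun l : Fin n => h l.succ)
      (fun l => hh l.succ) e) h1 h2 hc
  obtain ⟨p, hpV, hpI, hp⟩ := key
  obtain ⟨a, ha, hsum⟩ := exists_of_mem_idealPiece hpI
  have h1 : ∀ i, ((Fin.cons p (-a) : Fin (n + 1) → MvPolynomial (Fin n) K) i).IsHomogeneous e := by
    intro i
    induction i using Fin.cases with
    | zero => exact hpV
    | succ l => exact (ha l).neg
  have h2 : ∑ i, (Fin.cons p (-a) : Fin (n + 1) → MvPolynomial (Fin n) K) i * h i = 0 := by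
    rw [Fin.sum_univ_succ]
    simp [hsum]
  have h3 := apply_zero_mem_of_mem_span_koszulSyzygy (hex _ h1 h2)
  exact hp (mem_idealPiece (f := fun l : Fin n => h l.succ) (fun l => hh l.succ) hpV h3)

theorem isHomogeneous_X_pow_self {σ : Type*} (K : Type*) [CommRing K] (d : ℕ) (i : σ) :
    ((X i : MvPolynomial σ K) ^ d).IsHomogeneous d := by
  simpa using (isHomogeneous_X K i).pow d

universe w

/-- Pure powers are exact in every degree, so deforming them preserves the Hilbert function; for
pure powers it counts monomials and does not depend on the field. Below degree `d` both pieces are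
zero. -/
theorem exists_forall_finrank_eq {D L σ : Type*} [CommRing D] [Field L] [Fintype σ]
    [DecidableEq σ] (F : σ → MvPolynomial σ D) {d : ℕ} (hF : ∀ i, (F i).IsHomogeneous d)
    (φ : D →+* L) (hφ : ∀ i, map φ (F i) = X i ^ d) (j : ℕ) :
    ∃ P : D, φ P ≠ 0 ∧ ∀ (K : Type w) [Field K] (ψ : D →+* K), ψ P ≠ 0 →
      Module.finrank K (idealPiece (fun i => map ψ (F i)) d j) =
        Module.finrank K (idealPiece (fun i => (X i : MvPolynomial σ K) ^ d) d j) := by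
  have hφ' : (fun i => map φ (F i)) = fun i => X i ^ d := funext hφ
  rcases lt_or_ge j d with hj | hj
  · have : IsEmpty (Exponent σ d j) := ⟨fun β => by have := β.2; omega⟩
    refine ⟨1, by simp, fun K _ ψ _ => ?_⟩
    rw [idealPiece, idealPiece, Set.range_eq_empty, Set.range_eq_empty]
  · obtain ⟨e, rfl⟩ := Nat.exists_eq_add_of_le' hj
    obtain ⟨P, hP, h⟩ := exists_forall_exactInDegree.{w} F hF φ (e := e)
      (by rw [hφ']; exact exactInDegree_X_pow d e)
    refine ⟨P, hP, fun K _ ψ hψ => ?_⟩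
    have : Finite {β : σ →₀ ℕ // β.degree = e + d ∧ ∃ i, d ≤ β i} :=
      ((Finsupp.finite_of_degree_eq (e + d)).subset fun _ h => h.1).to_subtype
    rw [(h K ψ hψ).2, hφ', idealPiece_X_pow_eq_span, idealPiece_X_pow_eq_span,
      finrank_span_monomial, finrank_span_monomial]

/-- No `n + 1` forms of degree `d` in `n` variables are exact in degree
`⌈(n - 1) (d - 1) / 2⌉`. -/
theorem not_exactInDegree {k : Type*} [Field k] {n d e : ℕ} (hn : 2 ≤ n) (hd : 1 ≤ d)
    (he : e = ((n - 1) * (d - 1) + 1) / 2) {f : Fin (n + 1) → MvPolynomial (Fin n) k}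
    (hf : ∀ i, (f i).IsHomogeneous d) : ¬ ExactInDegree f e := by
  intro hex
  -- Only the last `n` forms of this endpoint of the pencil are used, so its zeroth entry may be
  -- `0`.
  let g : Fin (n + 1) → MvPolynomial (Fin n) k := Fin.cons 0 fun l => X l ^ d
  have hg : ∀ i, (g i).IsHomogeneous d := by
    intro i
    induction i using Fin.cases with
    | zero => exact isHomogeneous_zero _ _ _
    | succ l => exact isHomogeneous_X_pow_self k d l
  let F : Fin (n + 1) → MvPolynomial (Fin n) (Polynomial k) := fun i =>
    C Polynomial.X * map Polynomial.C (f i) + C (1 - Polynomial.X) * map Polynomial.C (g i)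
  have hF : ∀ i, (F i).IsHomogeneous d := fun i =>
    (((hf i).map _).C_mul _).add (((hg i).map _).C_mul _)
  have hmap : ∀ (t : k) i, map (Polynomial.evalRingHom t) (F i) =
      C t * f i + C (1 - t) * g i := by
    intro t i
    have hcomp : (Polynomial.evalRingHom t).comp Polynomial.C = RingHom.id k := by
      ext
      simp
    simp only [F, map_add, map_mul, map_C, map_map, hcomp, map_id]
    simp
  have hF1 : (fun i => map (Polynomial.evalRingHom (1 : k)) (F i)) = f := by
    funext i
    rw [hmap]
    simp
  have hF0 : ∀ l : Fin n, map (Polynomial.evalRingHom (0 : k)) (F l.succ) = X l ^ d := by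
    intro l
    rw [hmap]
    simp [g]
  obtain ⟨P, hP, hP'⟩ := exists_forall_exactInDegree F hF (Polynomial.evalRingHom (1 : k))
    (by rwa [hF1])
  obtain ⟨Q, hQ, hQ'⟩ := exists_forall_finrank_eq (fun l : Fin n => F l.succ)
    (fun l => hF l.succ) (Polynomial.evalRingHom (0 : k)) hF0 e
  obtain ⟨S, hS, hS'⟩ := exists_forall_finrank_eq (fun l : Fin n => F l.succ)
    (fun l => hF l.succ) (Polynomial.evalRingHom (0 : k)) hF0 (e + d)
  -- The conditions hold at different points, `t = 1` for `P` and `t = 0` for `Q` and `S`, and a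
  -- finite `k` may contain no common good `t`. All three are nonzero polynomials, so the generic
  -- point satisfies them together.
  let ψ := algebraMap (Polynomial k) (FractionRing (Polynomial k))
  have hψ : ∀ {t : k} {A : Polynomial k}, Polynomial.evalRingHom t A ≠ 0 → ψ A ≠ 0 := by
    intro t A hA h0
    have : A = 0 := (IsFractionRing.injective (Polynomial k) (FractionRing (Polynomial k)))
      (by rw [map_zero]; exact h0)
    rw [this, map_zero] at hA
    exact hA rfl
  have h1 := (hP' _ ψ (hψ hP)).1
  have h2 := hQ' _ ψ (hψ hQ)
  have h3 := hS' _ ψ (hψ hS)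
  refine not_exactInDegree_of_finrank (fun i => (hF i).map ψ) (c := boundedCount d n e)
    (c' := boundedCount d n (e + d : ℕ)) ?_ ?_ ?_ h1
  · rw [h2, finrank_idealPiece_X_pow]
  · rw [h3, finrank_idealPiece_X_pow]
  · have := boundedCount_add_lt hd hn he
    exact_mod_cast this

end NonExactness

/-! ### The Lefschetz example `ℓ^d, X_1^d, …, X_n^d` -/

section Example

variable {k : Type*} [Field k]

/-- The forms `(X_1 + ⋯ + X_n)^d, X_1^d, …, X_n^d`. -/
def lefschetzTuple (k : Type*) [Field k] (n d : ℕ) : Fin (n + 1) → MvPolynomial (Fin n) k :=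
  Fin.cons ((∑ i, X i) ^ d) fun l => X l ^ d

theorem lefschetzTuple_isHomogeneous (n d : ℕ) (i : Fin (n + 1)) :
    (lefschetzTuple k n d i).IsHomogeneous d := by
  induction i using Fin.cases with
  | zero =>
    have h : (∑ i, X i : MvPolynomial (Fin n) k).IsHomogeneous 1 :=
      IsHomogeneous.sum _ _ _ fun i _ => isHomogeneous_X k i
    simpa [lefschetzTuple] using h.pow d
  | succ l => exact isHomogeneous_X_pow_self k d l

theorem cons_zero_mem_span_koszulSyzygy {R : Type*} [CommRing R] {n : ℕ} (f : Fin (n + 1) → R)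
    {t : Fin n → R}
    (ht : t ∈ Submodule.span R (Set.range (koszulSyzygy fun l : Fin n => f l.succ))) :
    (Fin.cons 0 t : Fin (n + 1) → R) ∈ Submodule.span R (Set.range (koszulSyzygy f)) := by
  induction ht using Submodule.span_induction with
  | mem x hx =>
    obtain ⟨⟨i, j⟩, rfl⟩ := hx
    refine Submodule.subset_span ⟨(i.succ, j.succ), ?_⟩
    funext l
    induction l using Fin.cases with
    | zero => simp [koszulSyzygy, (Fin.succ_ne_zero _).symm]
    | succ l => simp [koszulSyzygy, Pi.single_apply]
  | zero =>
    convert Submodule.zero_mem _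
    funext l
    induction l using Fin.cases <;> rfl
  | add x y _ _ hx hy =>
    convert Submodule.add_mem _ hx hy
    funext l
    induction l using Fin.cases <;> simp
  | smul c x _ hx =>
    convert Submodule.smul_mem _ c hx
    funext l
    induction l using Fin.cases <;> simp

/-- The relation puts `ℓ^d * a 0` in the ideal of the pure powers, and strong Lefschetz puts `a 0`
there. Koszul syzygies clear the zeroth entry, leaving a syzygy of the pure powers. -/
theorem exactInDegree_lefschetzTuple [CharZero k] {n d e : ℕ}
    (he : (d : ℤ) + 2 * e ≤ n * ((d : ℤ) - 1)) : ExactInDegree (lefschetzTuple k n d) e := by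
  intro a ha hsum
  rw [Fin.sum_univ_succ] at hsum
  have h0 : a 0 ∈ Ideal.span (Set.range fun i : Fin n => (X i : MvPolynomial (Fin n) k) ^ d) := by
    refine mem_of_sum_X_pow_mul_mem e d (a 0) (ha 0) (by simpa using he) ?_
    have : (∑ i, X i) ^ d * a 0 =
        - ∑ l : Fin n, a l.succ * lefschetzTuple k n d l.succ := by
      rw [← eq_neg_of_add_eq_zero_left hsum, mul_comm]
      rfl
    rw [this]
    exact neg_mem (Ideal.sum_mem _ fun l _ => Ideal.mul_mem_left _ _ (Ideal.subset_span ⟨l, rfl⟩))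
  obtain ⟨b, hb⟩ := Ideal.mem_span_range_iff_exists_fun.1 h0
  have hkos : ∑ l : Fin n, b l • koszulSyzygy (lefschetzTuple k n d) (l.succ, 0) ∈
      Submodule.span _ (Set.range (koszulSyzygy (lefschetzTuple k n d))) :=
    Submodule.sum_mem _ fun l _ =>
      Submodule.smul_mem _ _ (Submodule.subset_span (Set.mem_range_self _))
  have htail : a - ∑ l : Fin n, b l • koszulSyzygy (lefschetzTuple k n d) (l.succ, 0) =
      Fin.cons 0 fun l => a l.succ + b l * (∑ i, X i) ^ d := by
    funext i
    induction i using Fin.cases with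
    | zero =>
      simp [koszulSyzygy, (Fin.succ_ne_zero _).symm, Finset.sum_apply, ← hb, lefschetzTuple]
    | succ l => simp [koszulSyzygy, Finset.sum_apply, Pi.single_apply, lefschetzTuple]
  rw [← sub_add_cancel a
    (∑ l : Fin n, b l • koszulSyzygy (lefschetzTuple k n d) (l.succ, 0)), htail]
  refine Submodule.add_mem _ (cons_zero_mem_span_koszulSyzygy (lefschetzTuple k n d) ?_) hkos
  refine mem_span_koszulSyzygy_X_pow d Finset.univ _ (by simp) ?_
  rw [← hsum, ← hb, Finset.sum_mul, ← Finset.sum_add_distrib]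
  refine Finset.sum_congr rfl fun l _ => ?_
  simp only [lefschetzTuple, Fin.cons_zero, Fin.cons_succ]
  ring

/-- Pigeonhole: a monomial of degree `n * d` has some exponent at least `d`. -/
theorem idealPiece_lefschetzTuple {n d : ℕ} (hn : 1 ≤ n) :
    idealPiece (lefschetzTuple k n d) d (n * d) = homogeneousSubmodule (Fin n) k (n * d) := by
  refine le_antisymm (idealPiece_le_homogeneousSubmodule (lefschetzTuple_isHomogeneous n d) _)
    fun p hp => mem_idealPiece (lefschetzTuple_isHomogeneous n d) hp ?_
  have h : p ∈ Ideal.span ((fun i : Fin n => (X i : MvPolynomial (Fin n) k) ^ d) '' Set.univ) := by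
    rw [mem_span_X_pow_iff]
    intro m hm
    by_contra! hlt
    have hdeg : m.degree = n * d := by
      by_contra h
      exact (mem_support_iff.1 hm) (IsHomogeneous.coeff_eq_zero hp h)
    rw [Finsupp.degree_eq_sum] at hdeg
    have : ∑ i, m i < ∑ _i : Fin n, d :=
      Finset.sum_lt_sum_of_nonempty ⟨⟨0, hn⟩, Finset.mem_univ _⟩ fun i _ => hlt i (Set.mem_univ i)
    simp at this
    omega
  refine Ideal.span_mono ?_ h
  rintro _ ⟨i, -, rfl⟩
  exact ⟨i.succ, rfl⟩

end Example

/-! ### A criterion for being `𝔪`-primary -/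

section MPrimary

variable {k : Type*} [Field k] {n : ℕ}

theorem idealOfVars_isMaximal : (idealOfVars (Fin n) k).IsMaximal := by
  have : idealOfVars (Fin n) k = RingHom.ker (constantCoeff : MvPolynomial (Fin n) k →+* k) := by
    ext p
    rw [← pow_one (idealOfVars (Fin n) k), mem_pow_idealOfVars_iff', RingHom.mem_ker]
    simp only [Nat.lt_one_iff, Finsupp.degree_eq_zero_iff, forall_eq, constantCoeff_eq]
  rw [this]
  exact RingHom.ker_isMaximal_of_surjective _ fun c => ⟨C c, by simp⟩

theorem isMPrimary_of_homogeneousSubmodule_le {f : Fin (n + 1) → MvPolynomial (Fin n) k} {d N : ℕ}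
    (hd : 1 ≤ d) (hf : ∀ i, (f i).IsHomogeneous d)
    (hN : ∀ p, p.IsHomogeneous N → p ∈ Ideal.span (Set.range f)) :
    IsMPrimary (Ideal.span (Set.range f)) := by
  have hrad : (Ideal.span (Set.range f)).radical = idealOfVars (Fin n) k := by
    refine le_antisymm ?_ (Ideal.span_le.2 ?_)
    · refine (idealOfVars_isMaximal.isPrime.radical_le_iff).2 (Ideal.span_le.2 ?_)
      rintro _ ⟨i, rfl⟩
      rw [SetLike.mem_coe, ← pow_one (idealOfVars (Fin n) k), mem_pow_idealOfVars_iff']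
      intro x hx
      exact (hf i).coeff_eq_zero (by omega)
    · rintro _ ⟨i, rfl⟩
      exact ⟨N, hN _ (isHomogeneous_X_pow_self k N i)⟩
  refine ⟨Ideal.isPrimary_of_isMaximal_radical ?_, hrad⟩
  rw [hrad]
  exact idealOfVars_isMaximal

end MPrimary

/-! ### From Koszul homology to the threshold degree -/

section Koszul

theorem koszulB1_eq_span {R : Type*} [CommRing R] {n : ℕ} (f : Fin (n + 1) → R) :
    koszulB1 f = Submodule.span R (Set.range (koszulSyzygy f)) := by
  rw [koszulB1, koszulD2, Fintype.range_linearCombination]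
  refine le_antisymm (Submodule.span_mono ?_) (Submodule.span_le.2 ?_)
  · rintro _ ⟨p, rfl⟩
    exact ⟨p.1, rfl⟩
  · rintro _ ⟨⟨i, j⟩, rfl⟩
    rcases lt_trichotomy i j with h | rfl | h
    · exact Submodule.subset_span ⟨⟨(i, j), h⟩, rfl⟩
    · simp [koszulSyzygy]
    · rw [SetLike.mem_coe, ← neg_neg (koszulSyzygy f (i, j))]
      refine neg_mem (Submodule.subset_span ⟨⟨(j, i), h⟩, ?_⟩)
      simp [koszulSyzygy]

/-- For a cycle `z`, the relation `∑ z j * f j = 0` gives `f i • z = ∑ z j • (f i e_j - f j e_i)`, a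
boundary. -/
theorem smul_koszulH1_eq_zero {R : Type*} [CommRing R] {n : ℕ} (f : Fin (n + 1) → R) {a : R}
    (ha : a ∈ Ideal.span (Set.range f)) (x : koszulH1 f) : a • x = 0 := by
  obtain ⟨z, rfl⟩ := Submodule.mkQ_surjective _ x
  rw [← map_smul, Submodule.mkQ_apply, Submodule.Quotient.mk_eq_zero]
  change a • (z : Fin (n + 1) → R) ∈ koszulB1 f
  rw [koszulB1_eq_span]
  have hz : ∑ j, (z : Fin (n + 1) → R) j * f j = 0 := by
    have := z.2
    rwa [LinearMap.mem_ker, koszulD1, Fintype.linearCombination_apply] at this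
  induction ha using Submodule.span_induction with
  | mem y hy =>
    obtain ⟨i, rfl⟩ := hy
    have : f i • (z : Fin (n + 1) → R) =
        ∑ j, (z : Fin (n + 1) → R) j • koszulSyzygy f (i, j) := by
      funext l
      simp only [koszulSyzygy, Finset.sum_apply, Pi.smul_apply, Pi.sub_apply, smul_eq_mul,
        mul_sub, Finset.sum_sub_distrib, ← mul_assoc, ← Finset.sum_mul, hz]
      simp [Pi.single_apply, mul_comm]
    rw [this]
    exact Submodule.sum_mem _ fun j _ =>
      Submodule.smul_mem _ _ (Submodule.subset_span (Set.mem_range_self _))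
  | zero => simp
  | add x y _ _ hx hy =>
    rw [add_smul]
    exact Submodule.add_mem _ hx hy
  | smul c x _ hx =>
    rw [smul_assoc]
    exact Submodule.smul_mem _ _ hx

variable {k : Type*} [Field k] {n : ℕ}

theorem localCohomologyZero_koszulH1_eq_top {f : Fin (n + 1) → MvPolynomial (Fin n) k}
    (hf : IsMPrimary (Ideal.span (Set.range f))) :
    localCohomologyZero (idealOfVars (Fin n) k) (koszulH1 f) = ⊤ := by
  obtain ⟨N, hN⟩ := Ideal.exists_radical_pow_le_of_fg (Ideal.span (Set.range f))
    (by rw [hf.2]; exact idealOfVars_fg _ _)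
  rw [hf.2] at hN
  exact eq_top_iff.2 fun x _ => ⟨N, fun a ha => smul_koszulH1_eq_zero f (hN ha) x⟩

theorem H1Piece_eq_bot_iff (d : ℕ) (f : Fin (n + 1) → MvPolynomial (Fin n) k) (ν : ℕ) :
    H1Piece d f ν = ⊥ ↔ (d ≤ ν → ExactInDegree f (ν - d)) := by
  have h1 : H1Piece d f ν = ⊥ ↔ ∀ a : Fin (n + 1) → MvPolynomial (Fin n) k,
      a ∈ K1Piece k n d ν → ∑ i, a i * f i = 0 →
        a ∈ Submodule.span (MvPolynomial (Fin n) k) (Set.range (koszulSyzygy f)) := by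
    rw [H1Piece, ← le_bot_iff, Submodule.map_le_iff_le_comap, ← koszulB1_eq_span]
    constructor
    · intro h a ha hsum
      have hz : a ∈ koszulZ1 f := by
        rwa [LinearMap.mem_ker, koszulD1, Fintype.linearCombination_apply]
      have : (⟨a, hz⟩ : koszulZ1 f) ∈ _ := h ha
      rw [Submodule.mem_comap, Submodule.mem_bot, LinearMap.restrictScalars_apply, Submodule.mkQ_apply,
        Submodule.Quotient.mk_eq_zero] at this
      exact this
    · intro h z hz
      rw [Submodule.mem_comap, Submodule.mem_bot, LinearMap.restrictScalars_apply, Submodule.mkQ_apply,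
        Submodule.Quotient.mk_eq_zero]
      refine h z hz ?_
      have := z.2
      rwa [LinearMap.mem_ker, koszulD1, Fintype.linearCombination_apply] at this
  rw [h1]
  by_cases hν : d ≤ ν
  · simp [K1Piece, ExactInDegree, hν]
  · simp only [K1Piece, Submodule.mem_pi, Set.mem_univ, true_imp_iff, hν, false_imp_iff, iff_true]
    intro a ha _
    rw [show a = 0 from funext ha]
    exact Submodule.zero_mem _

theorem indeg_eq {M : Type*} [AddCommGroup M] [Module k M] {piece : ℕ → Submodule k M} {ν : ℕ}
    (h : piece ν ≠ ⊥) (hlt : ∀ μ < ν, piece μ = ⊥) : indeg piece = (ν : EReal) := by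
  refine IsLeast.csInf_eq ⟨⟨ν, h, rfl⟩, ?_⟩
  rintro _ ⟨μ, hμ, rfl⟩
  have : ν ≤ μ := by
    by_contra hh
    exact hμ (hlt μ (by omega))
  exact_mod_cast this

/-- Both initial degrees equal `e + d`, so the second term of the minimum wins and its `-d` undoes
the shift of `K₁`. -/
theorem thresholdDegree_eq {d e : ℕ} {f : Fin (n + 1) → MvPolynomial (Fin n) k}
    (hf : IsMPrimary (Ideal.span (Set.range f))) (he : ¬ ExactInDegree f e)
    (hlt : ∀ e' < e, ExactInDegree f e') :
    thresholdDegree d f =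
      ((((((n : ℤ) - 1) * ((d : ℤ) - 1) - e : ℤ) : ℝ)) : EReal) := by
  have h1 : indeg (H1Piece d f) = ((e + d : ℕ) : EReal) := by
    refine indeg_eq ?_ fun μ hμ => ?_
    · rw [Ne, H1Piece_eq_bot_iff]
      simpa using he
    · rw [H1Piece_eq_bot_iff]
      exact fun hd => hlt _ (by omega)
  have h2 : H0mH1Piece d f = H1Piece d f := by
    funext ν
    rw [H0mH1Piece, localCohomologyZero_koszulH1_eq_top hf, Submodule.restrictScalars_top,
      inf_top_eq]
  have h3 : (((e + d : ℕ) : EReal) - (d : EReal)) = ((e : ℝ) : EReal) := by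
    have : (((e + d : ℕ) : EReal) - (d : EReal)) = (((e + d : ℕ) : ℝ) - (d : ℝ) : ℝ) := by
      rw [EReal.coe_sub]
      rfl
    rw [this]
    simp
  rw [thresholdDegree, h2, h1, h3, min_eq_right, ← EReal.coe_sub]
  · push_cast
    rfl
  · have : ((e + d : ℕ) : EReal) = (((e + d : ℕ) : ℝ) : EReal) := rfl
    rw [this, EReal.coe_le_coe_iff]
    push_cast
    linarith [Nat.cast_nonneg (α := ℝ) d]

theorem floor_eq {n d e : ℕ} (hn : 1 ≤ n) (hd : 1 ≤ d) (he : e = ((n - 1) * (d - 1) + 1) / 2) :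
    ⌊(((n : ℚ) - 1) * ((d : ℚ) - 1)) / 2⌋ = ((n : ℤ) - 1) * ((d : ℤ) - 1) - e := by
  obtain ⟨n, rfl⟩ := Nat.exists_eq_add_of_le' hn
  obtain ⟨d, rfl⟩ := Nat.exists_eq_add_of_le' hd
  have h := Rat.floor_intCast_div_natCast ((n : ℤ) * d) 2
  push_cast at h ⊢
  simp only [add_sub_cancel_right, Nat.add_sub_cancel] at he ⊢
  rw [h]
  have h2 : (n : ℤ) * d = ((n * d : ℕ) : ℤ) := by push_cast; rfl
  rw [h2]
  generalize n * d = N at *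
  omega

/-- A linear relation is a syzygy of degree `0`, whereas Koszul syzygies have entries of degree `d ≥
1`. -/
theorem linearIndependent_of_exactInDegree_zero {d : ℕ} (hd : 1 ≤ d)
    {f : Fin (n + 1) → MvPolynomial (Fin n) k} (hf : ∀ i, (f i).IsHomogeneous d)
    (h : ExactInDegree f 0) : LinearIndependent k f := by
  rw [Fintype.linearIndependent_iff]
  intro c hc i
  have ha : ∀ i, (C (c i) : MvPolynomial (Fin n) k).IsHomogeneous 0 := fun i =>
    isHomogeneous_C _ _
  have h1 := mem_koszulPiece hf ha (h (fun i => C (c i)) ha (by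
    simpa only [← smul_eq_C_mul] using hc))
  have : IsEmpty (Exponent (Fin n) d 0) := ⟨fun β => by have := β.2; omega⟩
  rw [koszulPiece, Set.range_eq_empty, Submodule.span_empty, Submodule.mem_bot] at h1
  have := congrFun h1 i
  simpa using this

end Koszul

/-! ### Forms with indeterminate coefficients -/

section GenericForms

variable {k : Type*} [Field k] {n d : ℕ}

/-- The tuple of forms of degree `d` with indeterminate coefficients. -/
def genericTuple (k : Type*) [Field k] (n d : ℕ) (i : Fin (n + 1)) :
    MvPolynomial (Fin n)
      (MvPolynomial (Fin (n + 1) × {α : Fin n →₀ ℕ // α.degree = d}) k) :=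
  letI := Fintype.ofFinite {α : Fin n →₀ ℕ // α.degree = d}
  ∑ α : {α : Fin n →₀ ℕ // α.degree = d}, monomial (α : Fin n →₀ ℕ) (X (i, α))

theorem genericTuple_isHomogeneous (i : Fin (n + 1)) :
    (genericTuple k n d i).IsHomogeneous d :=
  IsHomogeneous.sum _ _ _ fun α _ => isHomogeneous_monomial _ α.2

theorem map_genericTuple (f : FormTuple k n d) (i : Fin (n + 1)) :
    map (eval f.coords) (genericTuple k n d i) = f.poly i := by
  let _ := Fintype.ofFinite {α : Fin n →₀ ℕ // α.degree = d}
  ext β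
  simp only [genericTuple, map_sum, map_monomial, eval_X, coeff_sum, coeff_monomial,
    FormTuple.coords]
  by_cases hβ : β.degree = d
  · rw [Finset.sum_eq_single ⟨β, hβ⟩]
    · simp
    · intro α _ hα
      rw [if_neg fun h => hα (Subtype.ext h)]
    · intro h
      exact absurd (Finset.mem_univ _) h
  · rw [show coeff β (f.poly i) = 0 from IsHomogeneous.coeff_eq_zero (f i).2 hβ]
    refine Finset.sum_eq_zero fun α _ => ?_
    rw [if_neg fun h : (α : Fin n →₀ ℕ) = β => hβ (h ▸ α.2)]

end GenericForms

/-! ### The bound and the open set -/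

section Threshold

universe u

variable {k : Type u} [Field k] {n d e : ℕ}

/-- The bounds for the threshold degree of `𝔪`-primary ideals. -/
theorem exists_thresholdDegree_eq (hn : 2 ≤ n) (hd : 1 ≤ d)
    (he : e = ((n - 1) * (d - 1) + 1) / 2) (f : FormTuple k n d)
    (hf : IsMPrimary (Ideal.span (Set.range f.poly))) :
    ∃ e' ≤ e, thresholdDegree d f.poly =
      ((((((n : ℤ) - 1) * ((d : ℤ) - 1) - e' : ℤ) : ℝ)) : EReal) := by
  classical
  have hex : ∃ e', ¬ ExactInDegree f.poly e' := ⟨e, not_exactInDegree hn hd he fun i => (f i).2⟩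
  refine ⟨Nat.find hex, Nat.find_le (not_exactInDegree hn hd he fun i => (f i).2), ?_⟩
  exact thresholdDegree_eq hf (Nat.find_spec hex) fun e' he' => not_not.1 (Nat.find_min hex he')

theorem exists_isZariskiOpen [CharZero k] (hn : 2 ≤ n) (hd : 1 ≤ d)
    (he : e = ((n - 1) * (d - 1) + 1) / 2) :
    ∃ U : Set (FormTuple k n d), IsZariskiOpen U ∧ U.Nonempty ∧ ∀ f ∈ U,
      IsMPrimary (Ideal.span (Set.range f.poly)) ∧ ∀ e' < e, ExactInDegree f.poly e' := by
  let f₀ : FormTuple k n d := fun i =>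
    ⟨lefschetzTuple k n d i, lefschetzTuple_isHomogeneous n d i⟩
  have hmap : ∀ f : FormTuple k n d,
      (fun i => map (eval f.coords) (genericTuple k n d i)) = f.poly := fun f =>
    funext fun i => map_genericTuple f i
  have hf₀ : f₀.poly = lefschetzTuple k n d := rfl
  have hexact : ∀ e' < e, ExactInDegree f₀.poly e' := by
    intro e' he'
    rw [hf₀]
    -- For `e' < e` one has `2e' ≤ (n-1)(d-1) - 1 = n(d-1) - d`, which is exactly the Lefschetz
    -- range.
    refine exactInDegree_lefschetzTuple ?_
    obtain ⟨n, rfl⟩ := Nat.exists_eq_add_of_le' hn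
    obtain ⟨d, rfl⟩ := Nat.exists_eq_add_of_le' hd
    have h1 : n + 2 - 1 = n + 1 := rfl
    rw [h1, Nat.add_sub_cancel, add_mul, one_mul] at he
    have h3 : ((n + 2 : ℕ) : ℤ) * (((d + 1 : ℕ) : ℤ) - 1) = ((n * d : ℕ) : ℤ) + 2 * d := by
      push_cast; ring
    rw [h3]
    generalize n * d = N at *
    omega
  have hP : ∀ e' : ℕ, ∃ P, eval f₀.coords P ≠ 0 ∧ (e' < e → ∀ f : FormTuple k n d,
      eval f.coords P ≠ 0 → ExactInDegree f.poly e') := by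
    intro e'
    by_cases he' : e' < e
    · obtain ⟨P, hP, h⟩ := exists_forall_exactInDegree.{u} (genericTuple k n d)
        genericTuple_isHomogeneous (eval f₀.coords) (e := e')
        (by rw [hmap]; exact hexact e' he')
      refine ⟨P, hP, fun _ f hf => ?_⟩
      have := (h k (eval f.coords) hf).1
      rwa [hmap] at this
    · exact ⟨1, by simp, fun h => absurd h he'⟩
  choose P hP hP' using hP
  -- Where `Q` does not vanish the ideal contains all forms of degree `n * d`, hence is `𝔪`-primary.
  obtain ⟨Q, hQ, hQ'⟩ := exists_forall_finrank_idealPiece_le.{u} (genericTuple k n d) d (n * d)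
    (eval f₀.coords)
  rw [hmap, hf₀, idealPiece_lefschetzTuple (by omega)] at hQ'
  refine ⟨{f | ∃ A ∈ ({Q * ∏ e' ∈ Finset.range e, P e'} : Set _), eval f.coords A ≠ 0},
    ⟨_, rfl⟩, ⟨f₀, _, rfl, ?_⟩, ?_⟩
  · rw [map_mul, map_prod]
    exact mul_ne_zero hQ (Finset.prod_ne_zero_iff.2 fun e' _ => hP e')
  · rintro f ⟨_, rfl, hf⟩
    rw [map_mul, map_prod] at hf
    refine ⟨?_, fun e' he' => hP' e' he' f
      (Finset.prod_ne_zero_iff.1 (right_ne_zero_of_mul hf) e' (Finset.mem_range.2 he'))⟩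
    have h1 := hQ' k (eval f.coords) (left_ne_zero_of_mul hf)
    rw [hmap] at h1
    have hle := idealPiece_le_homogeneousSubmodule (f := f.poly) (fun i => (f i).2) (n * d)
    have h2 := Submodule.eq_of_le_of_finrank_le hle h1
    refine isMPrimary_of_homogeneousSubmodule_le (N := n * d) hd (fun i => (f i).2) fun p hp => ?_
    refine mem_ideal_of_mem_idealPiece (d := d) (j := n * d) ?_
    rw [h2]
    exact hp

end Threshold

end ThresholdDegree
end

theorem mainTheorem4 (k : Type*) [Field k] (n d : ℕ) (hn : 2 ≤ n) (hd : 1 ≤ d) :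
    (∀ f : ThresholdDegree.FormTuple k n d,
      LinearIndependent k f.poly →
      ThresholdDegree.IsMPrimary (Ideal.span (Set.range f.poly)) →
      ∃ μ₀ : ℤ, ThresholdDegree.thresholdDegree d f.poly = ((μ₀ : ℝ) : EReal) ∧
        ⌊(((n : ℚ) - 1) * ((d : ℚ) - 1)) / 2⌋ ≤ μ₀ ∧
        μ₀ ≤ ((n : ℤ) - 1) * ((d : ℤ) - 1)) ∧
    (CharZero k →
      ∃ U : Set (ThresholdDegree.FormTuple k n d),
        ThresholdDegree.IsZariskiOpen U ∧ U.Nonempty ∧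
        ∀ f ∈ U,
          (2 ≤ d → LinearIndependent k f.poly) ∧
          ThresholdDegree.IsMPrimary (Ideal.span (Set.range f.poly)) ∧
          ThresholdDegree.thresholdDegree d f.poly =
            ((⌊(((n : ℚ) - 1) * ((d : ℚ) - 1)) / 2⌋ : ℝ) : EReal)) := by
  rw [ThresholdDegree.floor_eq (by omega) hd rfl]
  constructor
  · intro f _ hf
    obtain ⟨e', he', h⟩ := ThresholdDegree.exists_thresholdDegree_eq hn hd rfl f hf
    exact ⟨_, h, by omega, by omega⟩
  · intro _
    obtain ⟨U, hU, hne, h⟩ := ThresholdDegree.exists_isZariskiOpen (k := k) hn hd rfl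
    refine ⟨U, hU, hne, fun f hf => ⟨fun hd2 => ?_, (h f hf).1, ?_⟩⟩
    · refine ThresholdDegree.linearIndependent_of_exactInDegree_zero hd (fun i => (f i).2)
        ((h f hf).2 0 ?_)
      -- For `d ≥ 2` the critical degree is positive, so degree `0` is among the exact degrees.
      have : 0 < (n - 1) * (d - 1) := Nat.mul_pos (by omega) (by omega)
      omega
    · exact ThresholdDegree.thresholdDegree_eq (h f hf).1
        (ThresholdDegree.not_exactInDegree hn hd rfl fun i => (f i).2) (h f hf).2
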